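/- Let $d\ge 0$, let $\mathcal P_1(\mathbb R^d)$ be the set of Borel probability measures on $\mathbb R^d$ with finite first moment, and let $\mu,\nu\in\mathcal P_1(\mathbb R^d)$ have a common barycentre $b=\int x\,d\mu=\int y\,d\nu$. Let $f:\mathbb R^d\to\mathbb R\cup\{+\infty\}$ be convex, lower semicontinuous and superlinear ($f(z)/|z|\to+\infty$ as $|z|\to\infty$). Write $\mu\preceq_c\rho$ (or $\rho\succeq_c\mu$) if $\int\varphi\,d\mu\le\int\varphi\,d\rho$ for every convex $\varphi:\mathbb R^d\to\mathbb R$. The optimal convex dominance problem is $$\inf\Big\{\int f\,d\rho\ :\ \rho\in\mathcal P_1(\mathbb R^d),\ \rho\succeq_c\mu,\ \rho\succeq_c\nu\Big\}.\tag{D}$$ Let $\Gamma Q(\mu,\nu)$ be the set of pairs $(\gamma,q)$ where $\gamma$ is a Borel probability measure on $\mathbb R^d\times\mathbb R^d$ with marginals $\mu$ and $\nu$, and $q$ is an $\mathbb R^d$-valued Borel measure on $\mathbb R^d\times\mathbb R^d$ with $q\ll\gamma$, first marginal $x\,\mu(dx)$ and second marginal $y\,\nu(dy)$. The bi-martingale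 problem with cost $f(z)$ is $$\inf\Big\{\iint f\Big(\frac{dq}{d\gamma}(x,y)\Big)\,\gamma(dx\,dy)\ :\ (\gamma,q)\in\Gamma Q(\mu,\nu)\Big\}.\tag{B}$$ A solution of (D) or (B) is an admissible element at which the infimum (possibly $+\infty$) is attained. Then: (1) $\inf(\mathrm D)=\inf(\mathrm B)$. (2) A pair $(\gamma,q)=(\gamma,\zeta\gamma)\in\Gamma Q(\mu,\nu)$, where $\zeta=dq/d\gamma$, solves (B) if and only if the push-forward $\rho=\zeta\#\gamma$ solves (D). (3) If, in addition, $f$ is strictly convex (that is, $f(ax+(1-a)y)<af(x)+(1-a)f(y)$ for all $0<a<1$ and all $x\ne y$ with $f(x),f(y)<+\infty$) and $\inf(\mathrm D)<+\infty$, then for every solution $\rho$ of (D) there is a solution $(\gamma,q)=(\gamma,\zeta\gamma)\in\Gamma Q(\mu,\nu)$ of (B) such that $\rho=\zeta\#\gamma$. (4) If $\inf(\mathrm D)<+\infty$, then (D) has a solution. -/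

import Mathlib

open MeasureTheory Set

noncomputable section

namespace BiMart

/-- The Euclidean space `ℝᵈ`. -/
abbrev E (d : ℕ) : Type := EuclideanSpace ℝ (Fin d)

/-- The integral `∫ g dρ` of an extended-real function, as the integral of the positive part minus
the integral of the negative part. It is used only where the negative part has a finite integral,
so that `∞ - ∞` does not occur. -/
def extIntegral {α : Type*} [MeasurableSpace α] (g : α → EReal) (ρ : Measure α) : EReal :=
  ((∫⁻ x, (g x).toENNReal ∂ρ : ENNReal) : EReal) - ((∫⁻ x, (-g x).toENNReal ∂ρ : ENNReal) : EReal)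

/-- Convexity of `f : ℝᵈ → ℝ ∪ {+∞}`. -/
def ConvexFun {d : ℕ} (f : E d → EReal) : Prop :=
  ∀ x y : E d, ∀ a b : ℝ, 0 < a → 0 < b → a + b = 1 →
    f (a • x + b • y) ≤ (a : EReal) * f x + (b : EReal) * f y

/-- Strict convexity of `f : ℝᵈ → ℝ ∪ {+∞}`: convexity, with a strict inequality between any two
distinct points at which `f` is finite. -/
def StrictConvexFun {d : ℕ} (f : E d → EReal) : Prop :=
  ConvexFun f ∧ ∀ x y : E d, x ≠ y → f x < ⊤ → f y < ⊤ →
    ∀ a b : ℝ, 0 < a → 0 < b → a + b = 1 →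
      f (a • x + b • y) < (a : EReal) * f x + (b : EReal) * f y

/-- Superlinearity: `f z / |z| → +∞` as `|z| → ∞`. -/
def Superlinear {d : ℕ} (f : E d → EReal) : Prop :=
  ∀ M : ℝ, ∃ R : ℝ, 0 < R ∧ ∀ z : E d, R ≤ ‖z‖ → ((M * ‖z‖ : ℝ) : EReal) ≤ f z

/-- Borel probability measures on `ℝᵈ` with a finite first moment. -/
def P1 (d : ℕ) : Set (Measure (E d)) :=
  {μ | IsProbabilityMeasure μ ∧ Integrable (fun x : E d => x) μ}

/-- The elements of `P1 d` with barycentre `b`. -/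
def P1b {d : ℕ} (b : E d) : Set (Measure (E d)) :=
  {μ | μ ∈ P1 d ∧ ∫ x, x ∂μ = b}

/-- The convex order `μ ⪯_c ν`; for `μ, ν` in `P1 d` both integrals are well defined in
`(-∞, +∞]`. -/
def ConvexOrder {d : ℕ} (μ ν : Measure (E d)) : Prop :=
  ∀ φ : E d → ℝ, ConvexOn ℝ univ φ →
    extIntegral (fun x => (φ x : EReal)) μ ≤ extIntegral (fun x => (φ x : EReal)) ν

/-- The common convex dominants of `μ` and `ν`: `ρ ∈ P1 d`, `ρ ⪰_c μ`, `ρ ⪰_c ν`. -/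
def Dominants {d : ℕ} (μ ν : Measure (E d)) : Set (Measure (E d)) :=
  {ρ | ρ ∈ P1 d ∧ ConvexOrder μ ρ ∧ ConvexOrder ν ρ}

/-- The infimum of the optimal convex dominance problem. -/
def dominanceInf {d : ℕ} (f : E d → EReal) (μ ν : Measure (E d)) : EReal :=
  ⨅ ρ ∈ Dominants μ ν, extIntegral f ρ

/-- `ρ` solves the optimal convex dominance problem: it is admissible and attains the infimum. -/
def IsOptimalDominant {d : ℕ} (f : E d → EReal) (μ ν ρ : Measure (E d)) : Prop :=
  ρ ∈ Dominants μ ν ∧ extIntegral f ρ = dominanceInf f μ ν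

/-- The transport plans between `μ` and `ν`. -/
def Plans {d : ℕ} (μ ν : Measure (E d)) : Set (Measure (E d × E d)) :=
  {γ | IsProbabilityMeasure γ ∧ γ.map Prod.fst = μ ∧ γ.map Prod.snd = ν}

/-- The vector-valued couplings `q`: the first marginal is `x μ` and the second one `y ν`. -/
def VectorCouplings {d : ℕ} (μ ν : Measure (E d)) : Set (VectorMeasure (E d × E d) (E d)) :=
  {q | q.map Prod.fst = μ.withDensityᵥ (fun x : E d => x) ∧
       q.map Prod.snd = ν.withDensityᵥ (fun y : E d => y)}

/-- The set `ΓQ(μ, ν)` of pairs of a plan `γ` and a vector-valued coupling `q ≪ γ`. Since `γ` is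
concentrated on the product of the supports of `μ` and `ν`, so is `q`. -/
def PlanPairs {d : ℕ} (μ ν : Measure (E d)) :
    Set (Measure (E d × E d) × VectorMeasure (E d × E d) (E d)) :=
  {p | p.1 ∈ Plans μ ν ∧ p.2 ∈ VectorCouplings μ ν ∧
       VectorMeasure.AbsolutelyContinuous p.2 p.1.toENNRealVectorMeasure}

/-- The `i`-th coordinate on `ℝᵈ`, as an additive map. -/
def coordHom (d : ℕ) (i : Fin d) : E d →+ ℝ where
  toFun v := v i
  map_zero' := rfl
  map_add' _ _ := rfl

theorem continuous_coordHom (d : ℕ) (i : Fin d) : Continuous (coordHom d i) :=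
  (EuclideanSpace.proj i : E d →L[ℝ] ℝ).continuous

/-- The `i`-th component `B ↦ (q B) i` of an `ℝᵈ`-valued measure `q`. -/
def component {α : Type*} [MeasurableSpace α] {d : ℕ} (q : VectorMeasure α (E d)) (i : Fin d) :
    SignedMeasure α :=
  q.mapRange (coordHom d i) (continuous_coordHom d i)

/-- The Radon-Nikodym derivative `dq/dγ` of an `ℝᵈ`-valued measure, coordinate by coordinate. -/
def vecRnDeriv {α : Type*} [MeasurableSpace α] {d : ℕ} (q : VectorMeasure α (E d))
    (γ : Measure α) (p : α) : E d :=
  WithLp.toLp 2 fun i : Fin d => (component q i).rnDeriv γ p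

/-- The cost `∬ c(x, y, dq/dγ(x, y)) γ(dx dy)` of a pair `(γ, q)`. -/
def pairCost {d : ℕ} (c : E d → E d → E d → EReal)
    (p : Measure (E d × E d) × VectorMeasure (E d × E d) (E d)) : EReal :=
  extIntegral (fun w : E d × E d => c w.1 w.2 (vecRnDeriv p.2 p.1 w)) p.1

/-- The infimum of the bi-martingale optimal transport problem with the cost `c`. -/
def biMartInf {d : ℕ} (c : E d → E d → E d → EReal) (μ ν : Measure (E d)) : EReal :=
  ⨅ p ∈ PlanPairs μ ν, pairCost c p

/-- `p = (γ, q)` solves the bi-martingale optimal transport problem with the cost `c`. -/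
def IsOptimalPair {d : ℕ} (c : E d → E d → E d → EReal) (μ ν : Measure (E d))
    (p : Measure (E d × E d) × VectorMeasure (E d × E d) (E d)) : Prop :=
  p ∈ PlanPairs μ ν ∧ pairCost c p = biMartInf c μ ν

end BiMart

end

/-!
The two problems are compared through conditional means.

*From pairs to dominants.* If `(γ, q)` is admissible and `ζ = dq/dγ`, the marginal conditions on `q`
say that, for `(X, Y) ∼ γ`, the conditional mean of `ζ(X, Y)` given either `X` or `Y` is that
variable. By Jensen's inequality the law of `ζ` dominates `μ` and `ν`
(`map_vecRnDeriv_mem_dominants`), and its `f`-integral is the cost of the pair.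

*From dominants to pairs.* If `ρ` dominates `μ` and `ν`, Strassen's theorem gives martingale
couplings of `μ` and of `ν` with `ρ`. Gluing them along `ρ` gives a triple `(X, Y, Z)` with
`𝔼[Z | X] = X` and `𝔼[Z | Y] = Y`. The law `γ` of `(X, Y)` and the density `ζ = 𝔼[Z | X, Y]` form
an admissible pair (`exists_planPair_of_mem_dominants`), and the conditional Jensen inequality bounds its cost by
`∫ f dρ`. Hence the infima agree and optimality corresponds. If `ρ` is optimal with a finite value,
then Jensen's inequality is an equality, so that `Z = ζ(X, Y)` almost surely when `f` is strictly
convex (`snd_eq_map_condMean`).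

*Strassen's theorem* (`exists_martCoupling`). For a finite partition of the space, the masses and
first moments of the pieces of `μ` are approximated by those of splittings of `ρ`: a separating
linear form would produce a maximum of finitely many affine functions violating the convex order.
Refining the partition and using Prokhorov's theorem yields a martingale coupling in the limit. Only
convex functions of linear growth are tested, which is what makes the next step possible.

*Existence.* Along a minimising sequence the superlinear `f` has bounded integrals. The sequence is
therefore tight, and functions of linear growth are uniformly integrable along it. A weak limit
satisfies the convex order for functions of linear growth, hence in full by Strassen's theorem, and
lower semicontinuity of `ρ ↦ ∫ f dρ` shows that it is optimal (`exists_minimal_dominant`).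

Since `f` is bounded below, it is written `F + c` with `F` valued in `[0, +∞]` and `c` real, and
extended integrals of `f` become Lebesgue integrals of `F` shifted by `c`.
-/

open ProbabilityTheory Filter Topology
open scoped ENNReal

namespace BiMart

/-! ### Jensen's inequality for lower semicontinuous convex functions -/

/-- A lower semicontinuous convex function with values in `[0, +∞]`. -/
structure ConvexLSC {d : ℕ} (F : E d → ℝ≥0∞) : Prop where
  lsc : LowerSemicontinuous F
  conv : ∀ x y : E d, ∀ a b : ℝ, 0 < a → 0 < b → a + b = 1 →
    F (a • x + b • y) ≤ ENNReal.ofReal a * F x + ENNReal.ofReal b * F y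

namespace ConvexLSC

variable {d : ℕ} {F : E d → ℝ≥0∞}

lemma measurable (hF : ConvexLSC F) : Measurable F := hF.lsc.measurable

/-- The point `(∫ z dκ, ∫ F dκ)` is the mean of points of the epigraph of `F`, which is closed and
convex. -/
lemma map_integral_le (hF : ConvexLSC F) (κ : Measure (E d)) [IsProbabilityMeasure κ]
    (hκ : Integrable (fun z : E d => z) κ) : F (∫ z, z ∂κ) ≤ ∫⁻ z, F z ∂κ := by
  by_cases htop : ∫⁻ z, F z ∂κ = ∞
  · simp [htop]
  have hfin : ∀ᵐ z ∂κ, F z < ∞ := ae_lt_top hF.measurable htop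
  let S : Set (E d × ℝ) := {p | F p.1 ≤ ENNReal.ofReal p.2} ∩ {p | 0 ≤ p.2}
  have hclosed : IsClosed S := by
    refine IsClosed.inter ?_ (isClosed_le continuous_const continuous_snd)
    exact hF.lsc.isClosed_epigraph.preimage
      (f := fun p : E d × ℝ => (p.1, ENNReal.ofReal p.2))
      (continuous_fst.prodMk (ENNReal.continuous_ofReal.comp continuous_snd))
  have hconv : Convex ℝ S := by
    rw [convex_iff_forall_pos]
    rintro ⟨z, t⟩ ⟨hz, ht⟩ ⟨w, s⟩ ⟨hw, hs⟩ a b ha hb hab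
    simp only [mem_ofPred_eq] at hz ht hw hs
    refine ⟨?_, by simp only [mem_ofPred_eq, Prod.snd_add, Prod.smul_snd, smul_eq_mul]; positivity⟩
    simp only [mem_ofPred_eq, Prod.fst_add, Prod.smul_fst, Prod.snd_add, Prod.smul_snd, smul_eq_mul]
    rw [ENNReal.ofReal_add (by positivity) (by positivity), ENNReal.ofReal_mul ha.le,
      ENNReal.ofReal_mul hb.le]
    refine (hF.conv z w a b ha hb hab).trans ?_
    gcongr
  have hint : Integrable (fun z => (F z).toReal) κ :=
    integrable_toReal_of_lintegral_ne_top hF.measurable.aemeasurable htop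
  have hmem := hconv.integral_mem hclosed (f := fun z => (z, (F z).toReal)) (μ := κ)
    (by filter_upwards [hfin] with z hz
        exact ⟨by simp [ENNReal.ofReal_toReal hz.ne], ENNReal.toReal_nonneg⟩)
    (hκ.prodMk hint)
  have h1 := hmem.1
  rw [integral_pair hκ hint] at h1
  simp only [mem_ofPred_eq] at h1
  rwa [integral_toReal hF.measurable.aemeasurable hfin, ENNReal.ofReal_toReal htop] at h1

/-- Equality in Jensen's inequality for a function that is strictly convex at midpoints: it would
be violated by the image of `κ` under `z ↦ (z + ∫ z dκ) / 2`, which has the same mean. -/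
lemma ae_eq_of_lintegral_le (hF : ConvexLSC F)
    (hs : ∀ x y, x ≠ y → F x < ∞ → F y < ∞ → F ((1 / 2 : ℝ) • x + (1 / 2 : ℝ) • y) <
      ENNReal.ofReal (1 / 2) * F x + ENNReal.ofReal (1 / 2) * F y)
    (κ : Measure (E d)) [IsProbabilityMeasure κ] (hκ : Integrable (fun z : E d => z) κ)
    (hle : ∫⁻ z, F z ∂κ ≤ F (∫ z, z ∂κ)) (hfin : ∫⁻ z, F z ∂κ < ∞) :
    ∀ᵐ z ∂κ, z = ∫ z, z ∂κ := by
  set m := ∫ z, z ∂κ with hm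
  have heq : ∫⁻ z, F z ∂κ = F m := le_antisymm hle (hF.map_integral_le κ hκ)
  have hhalf : ENNReal.ofReal (1 / 2) + ENNReal.ofReal (1 / 2) = 1 := by
    rw [← ENNReal.ofReal_add (by norm_num) (by norm_num)]; norm_num
  have hTm : Measurable fun z : E d => (1 / 2 : ℝ) • z + (1 / 2 : ℝ) • m := by fun_prop
  have hT : F m ≤ ∫⁻ z, F ((1 / 2 : ℝ) • z + (1 / 2 : ℝ) • m) ∂κ := by
    have : IsProbabilityMeasure (κ.map fun z : E d => (1 / 2 : ℝ) • z + (1 / 2 : ℝ) • m) :=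
      Measure.isProbabilityMeasure_map hTm.aemeasurable
    have hi : Integrable (fun z : E d => (1 / 2 : ℝ) • z + (1 / 2 : ℝ) • m) κ :=
      (hκ.smul (1 / 2 : ℝ)).add (integrable_const _)
    have h := hF.map_integral_le (κ.map fun z : E d => (1 / 2 : ℝ) • z + (1 / 2 : ℝ) • m)
      ((integrable_map_measure (by fun_prop) hTm.aemeasurable).2 hi)
    rw [lintegral_map hF.measurable hTm, integral_map hTm.aemeasurable (by fun_prop),
      integral_add (f := fun z : E d => (1 / 2 : ℝ) • z) (hκ.smul (1 / 2 : ℝ))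
        (integrable_const _), integral_smul, ← hm,
      integral_const, probReal_univ, one_smul, ← add_smul] at h
    norm_num at h ⊢
    exact h
  have hH : ∫⁻ z, (ENNReal.ofReal (1 / 2) * F z + ENNReal.ofReal (1 / 2) * F m) ∂κ = F m := by
    rw [lintegral_add_right _ measurable_const, lintegral_const_mul _ hF.measurable,
      lintegral_const, measure_univ, mul_one, heq, ← add_mul, hhalf, one_mul]
  have hGH : ∀ z, F ((1 / 2 : ℝ) • z + (1 / 2 : ℝ) • m) ≤
      ENNReal.ofReal (1 / 2) * F z + ENNReal.ofReal (1 / 2) * F m := fun z =>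
    hF.conv z m _ _ (by norm_num) (by norm_num) (by norm_num)
  have hae := ae_eq_of_ae_le_of_lintegral_le (μ := κ) (ae_of_all _ hGH)
    (((lintegral_mono hGH).trans_eq (hH.trans heq.symm)).trans_lt hfin).ne
    ((hF.measurable.const_mul _).add_const _).aemeasurable (hH.trans_le hT)
  filter_upwards [hae, ae_lt_top hF.measurable hfin.ne] with z hz hzf
  by_contra hne
  exact (hs z m hne hzf (heq ▸ hfin)).ne hz

end ConvexLSC

/-! ### Conditional means -/

/-- The conditional mean `a ↦ 𝔼[Z | A = a]` of the second coordinate of a joint law `τ` of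
`(A, Z)`. -/
noncomputable def condMean {α : Type*} [MeasurableSpace α] {d : ℕ} (τ : Measure (α × E d))
    [IsFiniteMeasure τ] (a : α) : E d :=
  ∫ z, z ∂τ.condKernel a

section CondMean

variable {α : Type*} [MeasurableSpace α] {d : ℕ} (τ : Measure (α × E d)) [IsFiniteMeasure τ]

lemma measurable_condMean : Measurable (condMean τ) :=
  (stronglyMeasurable_id.integral_kernel (κ := τ.condKernel)).measurable

variable {τ}

lemma integrable_condMean (hτ : Integrable (fun w : α × E d => w.2) τ) :
    Integrable (condMean τ) τ.fst :=
  hτ.integral_condKernel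

lemma setIntegral_condMean (hτ : Integrable (fun w : α × E d => w.2) τ) {s : Set α}
    (hs : MeasurableSet s) : ∫ a in s, condMean τ a ∂τ.fst = ∫ w in Prod.fst ⁻¹' s, w.2 ∂τ := by
  rw [← prod_univ, ← Measure.setIntegral_condKernel_univ_right hs hτ.integrableOn]
  rfl

lemma integrable_snd_iff {α : Type*} [MeasurableSpace α] {d : ℕ} {τ : Measure (α × E d)} :
    Integrable (fun w : α × E d => w.2) τ ↔ Integrable (fun z : E d => z) τ.snd := by
  rw [Measure.snd, integrable_map_measure (by fun_prop) (by fun_prop)]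
  rfl

lemma lintegral_condMean_le {F : E d → ℝ≥0∞} (hF : ConvexLSC F)
    (hτ : Integrable (fun w : α × E d => w.2) τ) :
    ∫⁻ a, F (condMean τ a) ∂τ.fst ≤ ∫⁻ z, F z ∂τ.snd := by
  rw [Measure.snd, lintegral_map hF.measurable measurable_snd,
    ← Measure.lintegral_condKernel (f := fun w => F w.2) (hF.measurable.comp measurable_snd)]
  refine lintegral_mono_ae ?_
  filter_upwards [hτ.condKernel_ae] with a ha
  exact hF.map_integral_le _ ha

/-- Equality in the conditional Jensen inequality, for a function that is strictly convex at
midpoints, forces `Z` to coincide with its conditional mean. -/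
lemma snd_eq_map_condMean {F : E d → ℝ≥0∞} (hF : ConvexLSC F)
    (hs : ∀ x y, x ≠ y → F x < ∞ → F y < ∞ → F ((1 / 2 : ℝ) • x + (1 / 2 : ℝ) • y) <
      ENNReal.ofReal (1 / 2) * F x + ENNReal.ofReal (1 / 2) * F y)
    (hτ : Integrable (fun w : α × E d => w.2) τ)
    (hle : ∫⁻ z, F z ∂τ.snd ≤ ∫⁻ a, F (condMean τ a) ∂τ.fst)
    (hfin : ∫⁻ z, F z ∂τ.snd < ∞) : τ.snd = τ.fst.map (condMean τ) := by
  have hJ := lintegral_condMean_le hF hτ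
  have hsnd : ∫⁻ z, F z ∂τ.snd = ∫⁻ a, ∫⁻ z, F z ∂τ.condKernel a ∂τ.fst := by
    rw [Measure.snd, lintegral_map hF.measurable measurable_snd,
      ← Measure.lintegral_condKernel (f := fun w => F w.2) (hF.measurable.comp measurable_snd)]
  have hmeas : Measurable fun a => ∫⁻ z, F z ∂τ.condKernel a := hF.measurable.lintegral_kernel
  have hae := ae_eq_of_ae_le_of_lintegral_le (μ := τ.fst) (f := fun a => F (condMean τ a))
    (g := fun a => ∫⁻ z, F z ∂τ.condKernel a)
    (by filter_upwards [hτ.condKernel_ae] with a ha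
        exact hF.map_integral_le _ ha) (hJ.trans_lt hfin).ne hmeas.aemeasurable
    (hsnd ▸ hle)
  have hfinae := ae_lt_top hmeas (hsnd ▸ hfin).ne
  have hκ : ∀ᵐ a ∂τ.fst, ∀ᵐ z ∂τ.condKernel a, z = condMean τ a := by
    filter_upwards [hae, hfinae, hτ.condKernel_ae] with a h1 h2 h3
    exact hF.ae_eq_of_lintegral_le hs _ h3 h1.symm.le h2
  have hτae : ∀ᵐ w ∂τ, w.2 = condMean τ w.1 := by
    have hset : MeasurableSet {w : α × E d | w.2 = condMean τ w.1} :=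
      measurableSet_eq_fun measurable_snd ((measurable_condMean τ).comp measurable_fst)
    have h := (Measure.ae_compProd_iff hset).2 hκ
    rwa [τ.disintegrate τ.condKernel] at h
  rw [Measure.fst, Measure.map_map (measurable_condMean τ) measurable_fst, Measure.snd]
  exact Measure.map_congr hτae

end CondMean

/-! ### The extended integral of a function bounded below by an integrable one -/

lemma extIntegral_eq_of_eq_add {α : Type*} [MeasurableSpace α] {ρ : Measure α} {g : α → EReal}
    {G : α → ℝ≥0∞} {l : α → ℝ} (hG : Measurable G) (hl : Integrable l ρ)
    (h : ∀ x, g x = (G x : EReal) + (l x : EReal)) :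
    extIntegral g ρ = ((∫⁻ x, G x ∂ρ : ℝ≥0∞) : EReal) + ((∫ x, l x ∂ρ : ℝ) : EReal) := by
  have hneg_le : ∀ x, (-g x).toENNReal ≤ ENNReal.ofReal (-l x) := by
    intro x
    rw [h x, ← EReal.real_coe_toENNReal (-l x)]
    apply EReal.toENNReal_le_toENNReal
    rw [EReal.coe_neg, EReal.neg_le_neg_iff]
    exact le_add_of_nonneg_left (EReal.coe_ennreal_nonneg _)
  have hpt : ∀ x, (g x).toENNReal + ENNReal.ofReal (-l x) =
      G x + ENNReal.ofReal (l x) + (-g x).toENNReal := by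
    intro x
    rw [h x]
    induction hGx : G x using ENNReal.recTopCoe with
    | top => simp
    | coe r =>
      have : ((r : ℝ≥0∞) : EReal) + (l x : EReal) = (((r : ℝ) + l x : ℝ) : EReal) := by
        rw [EReal.coe_nnreal_eq_coe_real, EReal.coe_add]
      rw [this, ← EReal.coe_neg, EReal.real_coe_toENNReal, EReal.real_coe_toENNReal,
        ← ENNReal.ofReal_coe_nnreal]
      have hr : (0 : ℝ) ≤ r := r.2
      rcases le_total 0 (l x) with h1 | h1
      · rw [ENNReal.ofReal_of_nonpos (p := -l x) (by linarith),
          ENNReal.ofReal_of_nonpos (p := -(r + l x)) (by linarith),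
          ENNReal.ofReal_add hr h1]
      · rw [ENNReal.ofReal_of_nonpos (p := l x) h1, add_zero]
        rcases le_total 0 ((r : ℝ) + l x) with h2 | h2
        · rw [ENNReal.ofReal_of_nonpos (p := -(r + l x)) (by linarith), add_zero,
            ← ENNReal.ofReal_add h2 (by linarith)]
          ring_nf
        · rw [ENNReal.ofReal_of_nonpos (p := (r + l x)) (by linarith), zero_add,
            ← ENNReal.ofReal_add hr (by linarith)]
          ring_nf
  have hgm : AEMeasurable (fun x => (-g x).toENNReal) ρ := by
    have : g = fun x => (G x : EReal) + (l x : EReal) := funext h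
    rw [this]
    have h1 : AEMeasurable (fun x => (G x : EReal) + (l x : EReal)) ρ :=
      hG.coe_ereal_ennreal.aemeasurable.add hl.aemeasurable.coe_real_ereal
    exact measurable_ereal_toENNReal.comp_aemeasurable h1.neg
  have hsum : (∫⁻ x, (g x).toENNReal ∂ρ) + ∫⁻ x, ENNReal.ofReal (-l x) ∂ρ =
      (∫⁻ x, G x ∂ρ) + (∫⁻ x, ENNReal.ofReal (l x) ∂ρ) + ∫⁻ x, (-g x).toENNReal ∂ρ := by
    rw [← lintegral_add_right' _ (g := fun x => ENNReal.ofReal (-l x))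
        hl.aemeasurable.neg.ennreal_ofReal,
      ← lintegral_add_right' _ hl.aemeasurable.ennreal_ofReal, ← lintegral_add_right' _ hgm]
    exact lintegral_congr hpt
  have hlp : ∫⁻ x, ENNReal.ofReal (l x) ∂ρ ≠ ∞ := hl.lintegral_lt_top.ne
  have hln : ∫⁻ x, ENNReal.ofReal (-l x) ∂ρ ≠ ∞ := hl.neg.lintegral_lt_top.ne
  have hgn : ∫⁻ x, (-g x).toENNReal ∂ρ ≠ ∞ := ne_top_of_le_ne_top hln (lintegral_mono hneg_le)
  rw [extIntegral, integral_eq_lintegral_pos_part_sub_lintegral_neg_part hl]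
  generalize ∫⁻ x, (g x).toENNReal ∂ρ = I at *
  generalize ∫⁻ x, (-g x).toENNReal ∂ρ = N at *
  generalize ∫⁻ x, ENNReal.ofReal (l x) ∂ρ = A at *
  generalize ∫⁻ x, ENNReal.ofReal (-l x) ∂ρ = B at *
  generalize ∫⁻ x, G x ∂ρ = J at *
  lift A to NNReal using hlp
  lift B to NNReal using hln
  lift N to NNReal using hgn
  induction J using ENNReal.recTopCoe with
  | top =>
    have : I = ∞ := by simpa using hsum
    subst this
    rw [EReal.coe_ennreal_top, EReal.top_add_coe]
    exact EReal.top_sub_coe N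
  | coe J =>
    have hI : I ≠ ∞ := by
      rintro rfl
      rw [top_add] at hsum
      exact ENNReal.coe_ne_top (r := J + A + N) (by push_cast; exact hsum.symm)
    lift I to NNReal using hI
    have h2 : (I : ℝ) + B = J + A + N := by exact_mod_cast hsum
    have h3 : ((I : ℝ) - N : ℝ) = J + (A - B) := by linarith
    have h4 := congrArg (fun t : ℝ => (t : EReal)) h3
    simpa only [EReal.coe_sub, EReal.coe_add, EReal.coe_nnreal_eq_coe_real,
      ENNReal.coe_toReal] using h4

/-! ### Martingale couplings and the convex order -/

/-- `π` is the joint law of a pair `(X, Z)` with `X ∼ μ`, `Z ∼ ρ` and `𝔼[Z | X] = X`; the last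
condition is expressed through the integrals of `Z` over the events `{X ∈ s}`. -/
structure MartCoupling {d : ℕ} (μ ρ : Measure (E d)) (π : Measure (E d × E d)) : Prop where
  fst_eq : π.fst = μ
  snd_eq : π.snd = ρ
  setIntegral_eq : ∀ s : Set (E d), MeasurableSet s →
    ∫ w in Prod.fst ⁻¹' s, w.2 ∂π = ∫ x in s, x ∂μ

section ConvexOrder

variable {d : ℕ} {μ ρ : Measure (E d)} {π : Measure (E d × E d)}

lemma continuous_of_convexOn_univ {φ : E d → ℝ} (hφ : ConvexOn ℝ univ φ) : Continuous φ :=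
  continuousOn_univ.1 (hφ.continuousOn isOpen_univ)

namespace MartCoupling

lemma isProbabilityMeasure (h : MartCoupling μ ρ π) (hμ : μ ∈ P1 d) : IsProbabilityMeasure π := by
  have := hμ.1
  constructor
  rw [← Measure.fst_univ, h.fst_eq, measure_univ]

lemma integrable_snd (h : MartCoupling μ ρ π) (hρ : ρ ∈ P1 d) :
    Integrable (fun w : E d × E d => w.2) π :=
  integrable_snd_iff.2 (h.snd_eq ▸ hρ.2)

lemma condMean_ae_eq [IsFiniteMeasure π] (h : MartCoupling μ ρ π) (hμ : μ ∈ P1 d)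
    (hρ : ρ ∈ P1 d) : ∀ᵐ x ∂μ, condMean π x = x := by
  have hint := h.integrable_snd hρ
  have h1 := integrable_condMean hint
  rw [h.fst_eq] at h1
  refine Integrable.ae_eq_of_forall_setIntegral_eq _ _ h1 hμ.2 fun s hs _ => ?_
  have h2 := setIntegral_condMean hint hs
  rw [h.fst_eq] at h2
  rw [h2, h.setIntegral_eq s hs]

lemma lintegral_le (h : MartCoupling μ ρ π) (hμ : μ ∈ P1 d) (hρ : ρ ∈ P1 d) {F : E d → ℝ≥0∞}
    (hF : ConvexLSC F) : ∫⁻ x, F x ∂μ ≤ ∫⁻ z, F z ∂ρ := by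
  have := h.isProbabilityMeasure hμ
  have h1 := lintegral_condMean_le hF (h.integrable_snd hρ)
  rw [h.fst_eq, h.snd_eq] at h1
  refine le_trans (lintegral_mono_ae ?_) h1
  filter_upwards [h.condMean_ae_eq hμ hρ] with x hx
  rw [hx]

lemma integral_eq (h : MartCoupling μ ρ π) : ∫ z, z ∂ρ = ∫ x, x ∂μ := by
  have h1 := h.setIntegral_eq univ .univ
  rw [preimage_univ, Measure.restrict_univ, Measure.restrict_univ] at h1
  rw [← h1, ← h.snd_eq, Measure.snd, integral_map (by fun_prop) (by fun_prop)]

/-- The easy half of Strassen's theorem: Jensen's inequality applies to `φ - l ≥ 0`, where `l` is an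
affine minorant of `φ`, while `l` has the same integral under both measures. -/
lemma convexOrder (h : MartCoupling μ ρ π) (hμ : μ ∈ P1 d) (hρ : ρ ∈ P1 d) :
    ConvexOrder μ ρ := by
  intro φ hφ
  have := hμ.1
  have := hρ.1
  have hcont := continuous_of_convexOn_univ hφ
  obtain ⟨l, c, hlc, -⟩ := hφ.exists_affine_le_of_lt (𝕜 := ℝ) (x := 0) (a := φ 0 - 1) (mem_univ _)
    (by linarith) isClosed_univ (hcont.lowerSemicontinuous.lowerSemicontinuousOn _)
  have hle : ∀ x, l x + c ≤ φ x := fun x => by simpa using hlc ⟨x, mem_univ x⟩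
  have hG : ConvexLSC fun x => ENNReal.ofReal (φ x - (l x + c)) := by
    refine ⟨Continuous.lowerSemicontinuous
      (ENNReal.continuous_ofReal.comp (by fun_prop)), fun x y a b ha hb hab => ?_⟩
    rw [← ENNReal.ofReal_mul ha.le, ← ENNReal.ofReal_mul hb.le,
      ← ENNReal.ofReal_add (mul_nonneg ha.le (by linarith [hle x]))
        (mul_nonneg hb.le (by linarith [hle y]))]
    apply ENNReal.ofReal_le_ofReal
    have h1 := hφ.2 (mem_univ x) (mem_univ y) ha.le hb.le hab
    simp only [smul_eq_mul, map_add, map_smul] at h1 ⊢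
    have h2 : c = (a + b) * c := by rw [hab, one_mul]
    linarith
  have key : ∀ m ∈ P1 d, extIntegral (fun x => (φ x : EReal)) m =
      ((∫⁻ x, ENNReal.ofReal (φ x - (l x + c)) ∂m : ℝ≥0∞) : EReal) +
        ((l (∫ x, x ∂m) + c : ℝ) : EReal) := by
    intro m hm
    have := hm.1
    have hli : Integrable (fun x => l x) m := l.integrable_comp hm.2
    rw [extIntegral_eq_of_eq_add (l := fun x => l x + c) hG.measurable
      (hli.add (integrable_const c)) (fun x => ?_)]
    · rw [integral_add hli (integrable_const c), integral_const, probReal_univ, one_smul,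
        l.integral_comp_comm hm.2]
    · rw [EReal.coe_ennreal_ofReal, max_eq_left (by linarith [hle x]), ← EReal.coe_add]
      congr 1
      ring
  rw [key μ hμ, key ρ hρ, h.integral_eq]
  gcongr
  exact EReal.coe_ennreal_le_coe_ennreal_iff.2 (h.lintegral_le hμ hρ hG)

end MartCoupling

/-- The convex order tested only against the convex functions of at most linear growth, which are
integrable under the elements of `P1 d`. -/
def LinearGrowthOrder (μ ρ : Measure (E d)) : Prop :=
  ∀ φ : E d → ℝ, ConvexOn ℝ univ φ → (∃ A : ℝ, ∀ x, |φ x| ≤ A * (1 + ‖x‖)) →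
    ∫ x, φ x ∂μ ≤ ∫ x, φ x ∂ρ

lemma integrable_of_linearGrowth {m : Measure (E d)} (hm : m ∈ P1 d) {φ : E d → ℝ}
    (hφ : Continuous φ) {A : ℝ} (hA : ∀ x, |φ x| ≤ A * (1 + ‖x‖)) : Integrable φ m := by
  have := hm.1
  refine Integrable.mono' (((integrable_const (1 : ℝ)).add hm.2.norm).const_mul A)
    hφ.aestronglyMeasurable (ae_of_all _ fun x => ?_)
  simpa using hA x

lemma ConvexOrder.linearGrowthOrder (hμ : μ ∈ P1 d) (hρ : ρ ∈ P1 d) (h : ConvexOrder μ ρ) :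
    LinearGrowthOrder μ ρ := by
  rintro φ hφ ⟨A, hA⟩
  have key : ∀ m ∈ P1 d, extIntegral (fun x => (φ x : EReal)) m = ((∫ x, φ x ∂m : ℝ) : EReal) := by
    intro m hm
    rw [extIntegral_eq_of_eq_add (G := fun _ => 0) (l := φ) measurable_const
      (integrable_of_linearGrowth hm (continuous_of_convexOn_univ hφ) hA) (by simp)]
    simp
  have h1 := h φ hφ
  rwa [key μ hμ, key ρ hρ, EReal.coe_le_coe_iff] at h1

end ConvexOrder

/-! ### Splitting a measure into pieces with prescribed masses and means -/

/-- The masses and first moments of the pieces of all splittings of `ρ` into measures `g i • ρ`,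
where `g` is a measurable partition of unity indexed by `ι`. -/
def splittingMoments {d : ℕ} (ρ : Measure (E d)) (ι : Type*) [Fintype ι] : Set (ι → ℝ × E d) :=
  {k | ∃ g : ι → E d → ℝ, (∀ i, Measurable (g i)) ∧ (∀ i z, 0 ≤ g i z) ∧ (∀ z, ∑ i, g i z = 1) ∧
    ∀ i, k i = (∫ z, g i z ∂ρ, ∫ z, g i z • z ∂ρ)}

section Splitting

variable {d : ℕ} {μ ρ : Measure (E d)} {ι : Type*} [Fintype ι]

lemma le_one_of_sum_eq_one {g : ι → E d → ℝ} (h0 : ∀ i z, 0 ≤ g i z) (h1 : ∀ z, ∑ i, g i z = 1)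
    (i : ι) (z : E d) : g i z ≤ 1 :=
  (Finset.single_le_sum (fun j _ => h0 j z) (Finset.mem_univ i)).trans_eq (h1 z)

lemma integrable_smul_of_bounded {W α : Type*} [MeasurableSpace α] [NormedAddCommGroup W]
    [NormedSpace ℝ W] {m : Measure α} {g : α → ℝ} (hg : Measurable g) {C : ℝ}
    (hC : ∀ z, |g z| ≤ C) {Φ : α → W} (hΦ : Integrable Φ m) : Integrable (fun z => g z • Φ z) m :=
  hΦ.bdd_smul C hg.aestronglyMeasurable (ae_of_all _ hC)

lemma abs_le_one_of_sum_eq_one {g : ι → E d → ℝ} (h0 : ∀ i z, 0 ≤ g i z)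
    (h1 : ∀ z, ∑ i, g i z = 1) (i : ι) (z : E d) : |g i z| ≤ 1 := by
  rw [abs_of_nonneg (h0 i z)]
  exact le_one_of_sum_eq_one h0 h1 i z

lemma convex_splittingMoments (hρ : ρ ∈ P1 d) : Convex ℝ (splittingMoments ρ ι) := by
  have := hρ.1
  rintro k ⟨g, hgm, hg0, hg1, hk⟩ k' ⟨g', hgm', hg0', hg1', hk'⟩ a b ha hb hab
  refine ⟨fun i z => a * g i z + b * g' i z, fun i => by fun_prop, fun i z => ?_, fun z => ?_,
    fun i => ?_⟩
  · have := hg0 i z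
    have := hg0' i z
    positivity
  · rw [Finset.sum_add_distrib, ← Finset.mul_sum, ← Finset.mul_sum, hg1, hg1', mul_one, mul_one,
      hab]
  · have i1 : Integrable (g i) ρ := by
      simpa using integrable_smul_of_bounded (hgm i) (abs_le_one_of_sum_eq_one hg0 hg1 i)
        (integrable_const (μ := ρ) (1 : ℝ))
    have i1' : Integrable (g' i) ρ := by
      simpa using integrable_smul_of_bounded (hgm' i) (abs_le_one_of_sum_eq_one hg0' hg1' i)
        (integrable_const (μ := ρ) (1 : ℝ))
    have i2 := integrable_smul_of_bounded (hgm i) (abs_le_one_of_sum_eq_one hg0 hg1 i) hρ.2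
    have i2' := integrable_smul_of_bounded (hgm' i) (abs_le_one_of_sum_eq_one hg0' hg1' i) hρ.2
    simp only [Pi.add_apply, Pi.smul_apply, hk, hk', add_smul, mul_smul]
    rw [integral_add (i1.const_mul a) (i1'.const_mul b),
      integral_add (f := fun z => a • g i z • z) (g := fun z => b • g' i z • z) (i2.smul a)
        (i2'.smul b), integral_const_mul,
      integral_const_mul, integral_smul, integral_smul]
    rfl

/-- The pointwise maximum of finitely many affine functions, the `i`-th one being given by a linear
form on `ℝ × ℝᵈ` applied to `(1, x)`. -/
noncomputable def maxAffine [Nonempty ι] (L : ι → ℝ × E d →L[ℝ] ℝ) (x : E d) : ℝ :=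
  Finset.univ.sup' Finset.univ_nonempty fun i => L i (1, x)

lemma le_maxAffine [Nonempty ι] (L : ι → ℝ × E d →L[ℝ] ℝ) (i : ι) (x : E d) :
    L i (1, x) ≤ maxAffine L x :=
  Finset.le_sup' (fun i => L i (1, x)) (Finset.mem_univ i)

lemma exists_eq_maxAffine [Nonempty ι] (L : ι → ℝ × E d →L[ℝ] ℝ) (x : E d) :
    ∃ i, L i (1, x) = maxAffine L x := by
  obtain ⟨i, -, hi⟩ := Finset.exists_mem_eq_sup' Finset.univ_nonempty fun i => L i (1, x)
  exact ⟨i, hi.symm⟩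

lemma convexOn_maxAffine [Nonempty ι] (L : ι → ℝ × E d →L[ℝ] ℝ) :
    ConvexOn ℝ univ (maxAffine L) := by
  refine ⟨convex_univ, fun x _ y _ a b ha hb hab => ?_⟩
  obtain ⟨i, hi⟩ := exists_eq_maxAffine L (a • x + b • y)
  have h1 : ((1 : ℝ), a • x + b • y) = a • ((1 : ℝ), x) + b • ((1 : ℝ), y) := by
    ext1 <;> simp [hab]
  rw [← hi, h1, map_add, map_smul, map_smul]
  gcongr <;> exact le_maxAffine L i _

lemma abs_maxAffine_le [Nonempty ι] (L : ι → ℝ × E d →L[ℝ] ℝ) (x : E d) :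
    |maxAffine L x| ≤ (∑ i, ‖L i‖) * (1 + ‖x‖) := by
  obtain ⟨i, hi⟩ := exists_eq_maxAffine L x
  rw [← hi, ← Real.norm_eq_abs]
  refine ((L i).le_opNorm _).trans ?_
  gcongr
  · exact Finset.single_le_sum (f := fun i => ‖L i‖) (fun j _ => norm_nonneg _) (Finset.mem_univ i)
  · refine (Prod.norm_def _).trans_le (max_le ?_ ?_)
    · simp
    · simp

/-- Some splitting of `ρ` realises the integral of a maximum of affine functions: the mass at each
point is shared equally between the affine functions which are maximal there. -/
lemma exists_mem_splittingMoments_sum_eq [Nonempty ι] (hρ : ρ ∈ P1 d)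
    (L : ι → ℝ × E d →L[ℝ] ℝ) :
    ∃ k ∈ splittingMoments ρ ι, ∑ i, L i (k i) = ∫ z, maxAffine L z ∂ρ := by
  classical
  have := hρ.1
  have hmax : Measurable (maxAffine L) :=
    (continuous_of_convexOn_univ (convexOn_maxAffine L)).measurable
  let M : ι → Set (E d) := fun i => {z | L i (1, z) = maxAffine L z}
  have hM : ∀ i, MeasurableSet (M i) := fun i => measurableSet_eq_fun (by fun_prop) hmax
  let u : ι → E d → ℝ := fun i => (M i).indicator 1
  have hum : ∀ i, Measurable (u i) := fun i => measurable_one.indicator (hM i)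
  have hu0 : ∀ i z, 0 ≤ u i z := fun i z => indicator_nonneg (fun _ _ => zero_le_one) z
  have hN : ∀ z, 0 < ∑ i, u i z := fun z => by
    obtain ⟨i, hi⟩ := exists_eq_maxAffine L z
    refine Finset.sum_pos' (fun j _ => hu0 j z) ⟨i, Finset.mem_univ i, ?_⟩
    simp [u, M, hi]
  let g : ι → E d → ℝ := fun i z => u i z / ∑ j, u j z
  have hgm : ∀ i, Measurable (g i) := fun i =>
    (hum i).div (Finset.measurable_sum _ fun j _ => hum j)
  have hg0 : ∀ i z, 0 ≤ g i z := fun i z => div_nonneg (hu0 i z) (hN z).le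
  have hg1 : ∀ z, ∑ i, g i z = 1 := fun z => by
    simp only [g]
    rw [← Finset.sum_div, div_self (hN z).ne']
  refine ⟨_, ⟨g, hgm, hg0, hg1, fun i => rfl⟩, ?_⟩
  have i1 : ∀ i, Integrable (fun z => g i z • ((1 : ℝ), z)) ρ := fun i =>
    integrable_smul_of_bounded (hgm i) (abs_le_one_of_sum_eq_one hg0 hg1 i)
      ((integrable_const (1 : ℝ)).prodMk hρ.2)
  have hpair : ∀ i, (∫ z, g i z ∂ρ, ∫ z, g i z • z ∂ρ) = ∫ z, g i z • ((1 : ℝ), z) ∂ρ := fun i => by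
    have h1 := (i1 i).fst
    have h2 := (i1 i).snd
    simp only [Prod.smul_mk, smul_eq_mul, mul_one] at h1 h2 ⊢
    exact (integral_pair h1 h2).symm
  calc ∑ i, L i (∫ z, g i z ∂ρ, ∫ z, g i z • z ∂ρ)
      = ∑ i, ∫ z, g i z * L i (1, z) ∂ρ := by
        refine Finset.sum_congr rfl fun i _ => ?_
        rw [hpair, ← (L i).integral_comp_comm (i1 i)]
        simp only [map_smul, smul_eq_mul]
    _ = ∫ z, ∑ i, g i z * L i (1, z) ∂ρ := by
        rw [integral_finsetSum]
        intro i _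
        have := (L i).integrable_comp (i1 i)
        simpa only [map_smul, smul_eq_mul] using this
    _ = ∫ z, maxAffine L z ∂ρ := by
        refine integral_congr_ae (ae_of_all _ fun z => ?_)
        have : ∀ i, g i z * L i (1, z) = g i z * maxAffine L z := fun i => by
          by_cases hi : L i (1, z) = maxAffine L z
          · rw [hi]
          · simp [g, u, M, hi]
        simp only [this]
        rw [← Finset.sum_mul, hg1, one_mul]

/-- The finite-dimensional core of Strassen's theorem. A linear form that strictly separated the
moments of the partition `A` from those of all splittings of `ρ` would yield a maximum `φ` of affine
functions with `∫ φ dρ < ∫ φ dμ`. -/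
lemma moments_mem_closure_splittingMoments (hμ : μ ∈ P1 d) (hρ : ρ ∈ P1 d)
    (h : LinearGrowthOrder μ ρ) (A : ι → Set (E d)) (hA : ∀ i, MeasurableSet (A i))
    (hdisj : Pairwise (Function.onFun Disjoint A)) (hU : ⋃ i, A i = univ) :
    (fun i => (μ.real (A i), ∫ x in A i, x ∂μ)) ∈ closure (splittingMoments ρ ι) := by
  classical
  have := hμ.1
  have : Nonempty ι := by
    have h0 : (0 : E d) ∈ ⋃ i, A i := hU ▸ mem_univ _
    exact ⟨(mem_iUnion.1 h0).choose⟩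
  by_contra hnot
  obtain ⟨Λ, u, hu, hlt⟩ := geometric_hahn_banach_closed_point
    (convex_splittingMoments hρ).closure isClosed_closure hnot
  let L : ι → ℝ × E d →L[ℝ] ℝ := fun i =>
    Λ.comp (ContinuousLinearMap.single ℝ (fun _ : ι => ℝ × E d) i)
  have hΛ : ∀ k : ι → ℝ × E d, Λ k = ∑ i, L i (k i) := fun k => by
    conv_lhs => rw [← Finset.univ_sum_single k]
    rw [map_sum]
    rfl
  obtain ⟨k, hk, hkL⟩ := exists_mem_splittingMoments_sum_eq hρ L
  have h1 := hu k (subset_closure hk)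
  rw [hΛ, hkL] at h1
  have hint := integrable_of_linearGrowth hμ (continuous_of_convexOn_univ (convexOn_maxAffine L))
    (abs_maxAffine_le L)
  have h2 := h _ (convexOn_maxAffine L) ⟨_, abs_maxAffine_le L⟩
  have hi : Integrable (fun x : E d => ((1 : ℝ), x)) μ := (integrable_const (1 : ℝ)).prodMk hμ.2
  have h3 : Λ (fun i => (μ.real (A i), ∫ x in A i, x ∂μ)) ≤ ∫ x, maxAffine L x ∂μ := by
    rw [hΛ, ← setIntegral_univ, ← hU, integral_iUnion_fintype hA hdisj fun i => hint.integrableOn]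
    refine Finset.sum_le_sum fun i _ => ?_
    have hpair : (μ.real (A i), ∫ x in A i, x ∂μ) = ∫ x in A i, ((1 : ℝ), x) ∂μ := by
      rw [integral_pair (integrable_const _) hμ.2.integrableOn]
      simp
    rw [hpair, ← (L i).integral_comp_comm hi.integrableOn]
    exact setIntegral_mono ((L i).integrable_comp hi).integrableOn hint.integrableOn
      fun x => le_maxAffine L i x
  linarith

end Splitting

/-! ### Approximate couplings -/

section ApproximateCouplings

variable {d : ℕ} {μ ρ : Measure (E d)}

/-- The joint law in which the second coordinate is distributed according to `ρ` and, given that it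
equals `z`, the first coordinate is `c i` with probability `g i z`. -/
noncomputable def splittingCoupling {ι : Type*} [Fintype ι] (ρ : Measure (E d)) (c : ι → E d)
    (g : ι → E d → ℝ) : Measure (E d × E d) :=
  ∑ i, (ρ.withDensity fun z => ENNReal.ofReal (g i z)).map fun z => (c i, z)

section SplittingCoupling

variable {ι : Type*} [Fintype ι] {c : ι → E d} {g : ι → E d → ℝ}

lemma snd_splittingCoupling (hgm : ∀ i, Measurable (g i)) (hg0 : ∀ i z, 0 ≤ g i z)
    (hg1 : ∀ z, ∑ i, g i z = 1) : (splittingCoupling ρ c g).snd = ρ := by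
  ext B hB
  rw [Measure.snd_apply hB, splittingCoupling, Measure.finsetSum_apply]
  have : ∀ i, ((ρ.withDensity fun z => ENNReal.ofReal (g i z)).map fun z => (c i, z))
      (Prod.snd ⁻¹' B) = ∫⁻ z in B, ENNReal.ofReal (g i z) ∂ρ := fun i => by
    rw [Measure.map_apply (by fun_prop) (measurable_snd hB), ← preimage_comp]
    exact withDensity_apply _ hB
  simp only [this]
  rw [← lintegral_finsetSum _ fun i _ => (hgm i).ennreal_ofReal]
  simp_rw [← ENNReal.ofReal_sum_of_nonneg fun i _ => hg0 i _, hg1]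
  simp

lemma integral_splittingCoupling {W : Type*} [NormedAddCommGroup W] [NormedSpace ℝ W]
    (hgm : ∀ i, Measurable (g i)) (hg0 : ∀ i z, 0 ≤ g i z) {Φ : E d × E d → W}
    (hΦ : StronglyMeasurable Φ) (hint : ∀ i, Integrable (fun z => g i z • Φ (c i, z)) ρ) :
    ∫ w, Φ w ∂splittingCoupling ρ c g = ∑ i, ∫ z, g i z • Φ (c i, z) ∂ρ := by
  have hreal : ∀ i z, (ENNReal.ofReal (g i z)).toReal = g i z := fun i z =>
    ENNReal.toReal_ofReal (hg0 i z)
  have hmeas : ∀ i, Measurable fun z : E d => (c i, z) := fun i => by fun_prop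
  rw [splittingCoupling, integral_finsetSum_measure]
  · refine Finset.sum_congr rfl fun i _ => ?_
    rw [integral_map (hmeas i).aemeasurable hΦ.aestronglyMeasurable,
      integral_withDensity_eq_integral_toReal_smul (hgm i).ennreal_ofReal (by simp)]
    simp only [hreal]
  · intro i _
    rw [integrable_map_measure hΦ.aestronglyMeasurable (hmeas i).aemeasurable,
      integrable_withDensity_iff_integrable_smul' (hgm i).ennreal_ofReal (by simp)]
    simpa only [hreal, Function.comp_apply] using hint i

end SplittingCoupling

/-- A probability measure with second marginal `ρ` which almost satisfies the martingale constraint,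
for the discretisation `s` of the first coordinate. -/
lemma exists_approx_coupling (hμ : μ ∈ P1 d) (hρ : ρ ∈ P1 d) (h : LinearGrowthOrder μ ρ)
    (s : SimpleFunc (E d) (E d)) {δ : ℝ} (hδ : 0 < δ) :
    ∃ π : Measure (E d × E d), IsProbabilityMeasure π ∧ π.snd = ρ ∧
      ∀ (f : E d → ℝ) (C : ℝ), Measurable f → (∀ x, |f x| ≤ C) →
        |∫ w, f w.1 ∂π - ∫ x, f (s x) ∂μ| ≤ C * δ ∧
        ‖∫ w, f w.1 • w.2 ∂π - ∫ x, f (s x) • x ∂μ‖ ≤ C * δ := by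
  have := hμ.1
  have := hρ.1
  let A : s.range → Set (E d) := fun c => s ⁻¹' {c.1}
  have hA : ∀ c, MeasurableSet (A c) := fun c => s.measurableSet_preimage _
  have hdisj : Pairwise (Function.onFun Disjoint A) := fun c c' hcc' => by
    exact Disjoint.preimage _ (disjoint_singleton.2 fun h => hcc' (Subtype.ext h))
  have hU : ⋃ c, A c = univ := by
    refine eq_univ_of_forall fun x => mem_iUnion.2 ⟨⟨s x, s.mem_range_self x⟩, ?_⟩
    simp [A]
  have hpos : 0 < δ / (Fintype.card s.range + 1) := by positivity
  obtain ⟨k, ⟨g, hgm, hg0, hg1, hk⟩, hdist⟩ := Metric.mem_closure_iff.1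
    (moments_mem_closure_splittingMoments hμ hρ h A hA hdisj hU) _ hpos
  rw [dist_comm, dist_pi_lt_iff hpos] at hdist
  have hdist1 : ∀ c, |∫ z, g c z ∂ρ - μ.real (A c)| ≤ δ / (Fintype.card s.range + 1) := fun c => by
    have h1 := (hdist c).le
    rw [hk, Prod.dist_eq] at h1
    exact (le_max_left _ _).trans h1
  have hdist2 : ∀ c, ‖∫ z, g c z • z ∂ρ - ∫ x in A c, x ∂μ‖ ≤ δ / (Fintype.card s.range + 1) :=
    fun c => by
    have h1 := (hdist c).le
    rw [hk, Prod.dist_eq, dist_eq_norm (_ : E d)] at h1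
    exact (le_max_right _ _).trans h1
  have hcard : ∀ C : ℝ, 0 ≤ C →
      ∑ _c : s.range, C * (δ / (Fintype.card s.range + 1)) ≤ C * δ := fun C hC => by
    rw [Finset.sum_const, nsmul_eq_mul, Finset.card_univ, mul_left_comm]
    gcongr
    rw [mul_div_assoc', div_le_iff₀ (by positivity)]
    nlinarith
  have hsnd := snd_splittingCoupling (ρ := ρ) (c := fun c : s.range => c.1) hgm hg0 hg1
  refine ⟨splittingCoupling ρ (fun c : s.range => c.1) g, ⟨?_⟩, hsnd, fun f C hf hC => ?_⟩
  · rw [← Measure.snd_univ, hsnd, measure_univ]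
  have hC0 : 0 ≤ C := (abs_nonneg _).trans (hC 0)
  -- An integral of `f (s x)` against `μ` is a sum over the cells, on which `f (s x)` is constant.
  have hcells : ∀ {W : Type} [NormedAddCommGroup W] [NormedSpace ℝ W] (Φ : E d → W),
      Integrable Φ μ → ∫ x, f (s x) • Φ x ∂μ = ∑ c : s.range, f c.1 • ∫ x in A c, Φ x ∂μ := by
    intro W _ _ Φ hΦ
    have hi : Integrable (fun x => f (s x) • Φ x) μ :=
      integrable_smul_of_bounded (hf.comp s.measurable) (fun x => hC _) hΦ
    rw [← setIntegral_univ, ← hU, integral_iUnion_fintype hA hdisj fun i => hi.integrableOn]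
    refine Finset.sum_congr rfl fun c _ => ?_
    rw [← integral_smul]
    refine setIntegral_congr_fun (hA c) fun x hx => ?_
    have hx' : s x = c.1 := hx
    simp only [hx']
  have hgi : ∀ c, Integrable (g c) ρ := fun c => by
    simpa using integrable_smul_of_bounded (hgm c) (abs_le_one_of_sum_eq_one hg0 hg1 c)
      (integrable_const (μ := ρ) (1 : ℝ))
  have hgz : ∀ c, Integrable (fun z => g c z • z) ρ := fun c =>
    integrable_smul_of_bounded (hgm c) (abs_le_one_of_sum_eq_one hg0 hg1 c) hρ.2
  constructor
  · have h1 := hcells (fun _ => (1 : ℝ)) (integrable_const 1)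
    simp only [smul_eq_mul, mul_one, integral_const, MeasurableSet.univ, measureReal_restrict_apply,
      univ_inter] at h1
    rw [h1, integral_splittingCoupling (Φ := fun w => f w.1) hgm hg0
      (hf.comp measurable_fst).stronglyMeasurable
      (fun c => by simpa using (hgi c).mul_const (f c.1)), ← Finset.sum_sub_distrib]
    refine (Finset.abs_sum_le_sum_abs _ _).trans (le_trans (Finset.sum_le_sum fun c _ => ?_)
      (hcard C hC0))
    simp only [smul_eq_mul]
    rw [integral_mul_const, mul_comm, ← mul_sub, abs_mul]
    exact mul_le_mul (hC _) (hdist1 c) (abs_nonneg _) hC0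
  · rw [hcells (fun x => x) hμ.2, integral_splittingCoupling (Φ := fun w => f w.1 • w.2) hgm hg0
      ((hf.comp measurable_fst).smul measurable_snd).stronglyMeasurable
      (fun c => by simpa only [smul_comm (g c _)] using! (hgz c).smul (f c.1)),
      ← Finset.sum_sub_distrib]
    refine (norm_sum_le _ _).trans (le_trans (Finset.sum_le_sum fun c _ => ?_) (hcard C hC0))
    simp only [smul_comm (g c _)]
    rw [integral_smul, ← smul_sub, norm_smul]
    exact mul_le_mul (hC _) (hdist2 c) (norm_nonneg _) hC0

end ApproximateCouplings

/-! ### Weak limits of probability measures -/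

section WeakLimits

variable {Ω : Type*} [TopologicalSpace Ω] [MeasurableSpace Ω] [OpensMeasurableSpace Ω]

/-- Integrals of a continuous, uniformly integrable function converge along weakly convergent
sequences. The uniform integrability is expressed through the excess `(|g| - R)⁺`, which is the
distance of `g` to its truncation to `[-R, R]`. -/
lemma tendsto_integral_of_excess {P : ℕ → ProbabilityMeasure Ω} {P₀ : ProbabilityMeasure Ω}
    (hP : Tendsto P atTop (𝓝 P₀)) {g : Ω → ℝ} (hg : Continuous g)
    (hint : ∀ n, Integrable g (P n : Measure Ω)) (hint₀ : Integrable g (P₀ : Measure Ω))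
    (hUI : ∀ ε : ℝ, 0 < ε → ∃ R : ℝ, 0 ≤ R ∧ (∀ n, ∫ x, max (|g x| - R) 0 ∂(P n : Measure Ω) ≤ ε) ∧
      ∫ x, max (|g x| - R) 0 ∂(P₀ : Measure Ω) ≤ ε) :
    Tendsto (fun n => ∫ x, g x ∂(P n : Measure Ω)) atTop (𝓝 (∫ x, g x ∂(P₀ : Measure Ω))) := by
  rw [Metric.tendsto_atTop]
  intro ε hε
  obtain ⟨R, hR, hRn, hR0⟩ := hUI (ε / 4) (by positivity)
  let t : Ω → ℝ := fun x => max (-R) (min R (g x))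
  have ht : Continuous t := by fun_prop
  have htb : ∀ x, |t x| ≤ R := fun x =>
    abs_le.2 ⟨le_max_left _ _, max_le (by linarith) (min_le_left _ _)⟩
  have hgt : ∀ x, |g x - t x| = max (|g x| - R) 0 := by
    intro x
    simp only [t]
    rcases le_total (g x) (-R) with h1 | h1
    · rw [min_eq_right (by linarith), max_eq_left h1, abs_of_nonpos (by linarith : g x ≤ 0),
        abs_of_nonpos (by linarith), max_eq_left (by linarith)]
      ring
    · rcases le_total (g x) R with h2 | h2
      · rw [min_eq_right h2, max_eq_right h1, sub_self, abs_zero, max_eq_right]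
        linarith [abs_le.2 ⟨h1, h2⟩]
      · rw [min_eq_left h2, max_eq_right (by linarith), abs_of_nonneg (by linarith : 0 ≤ g x),
          abs_of_nonneg (by linarith), max_eq_left (by linarith)]
  have hbound : ∀ Q : ProbabilityMeasure Ω, Integrable g (Q : Measure Ω) →
      ∫ x, max (|g x| - R) 0 ∂(Q : Measure Ω) ≤ ε / 4 →
      |∫ x, g x ∂(Q : Measure Ω) - ∫ x, t x ∂(Q : Measure Ω)| ≤ ε / 4 := by
    intro Q hQ hQR
    have hti : Integrable t (Q : Measure Ω) :=
      Integrable.mono' (integrable_const R) ht.aestronglyMeasurable (ae_of_all _ htb)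
    rw [← integral_sub hQ hti]
    refine (abs_integral_le_integral_abs).trans ?_
    simpa only [hgt] using hQR
  have hT := ProbabilityMeasure.tendsto_iff_forall_integral_tendsto.1 hP
    (BoundedContinuousFunction.ofNormedAddCommGroup t ht R htb)
  obtain ⟨N, hN⟩ := Metric.tendsto_atTop.1 hT (ε / 4) (by positivity)
  refine ⟨N, fun n hn => ?_⟩
  have h1 := hN n hn
  simp only [BoundedContinuousFunction.coe_ofNormedAddCommGroup, Real.dist_eq] at h1 ⊢
  have h2 := abs_le.1 (hbound (P n) (hint n) (hRn n))
  have h3 := abs_le.1 (hbound P₀ hint₀ hR0)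
  have h4 := abs_lt.1 h1
  rw [abs_lt]
  constructor <;> linarith [h2.1, h2.2, h3.1, h3.2, h4.1, h4.2]

end WeakLimits

lemma exists_subseq_tendsto_of_isTight {X : Type*} [MetricSpace X] [SecondCountableTopology X]
    [MeasurableSpace X] [BorelSpace X] (P : ℕ → ProbabilityMeasure X)
    (hP : IsTightMeasureSet (range fun n => (P n : Measure X))) :
    ∃ (P₀ : ProbabilityMeasure X) (φ : ℕ → ℕ), StrictMono φ ∧ Tendsto (P ∘ φ) atTop (𝓝 P₀) := by
  have hc : IsCompact (closure (range P)) := by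
    refine isCompact_closure_of_isTightMeasureSet (hP.subset ?_)
    rintro _ ⟨_, ⟨n, rfl⟩, rfl⟩
    exact ⟨n, rfl⟩
  obtain ⟨P₀, -, φ, hφ, h⟩ := hc.tendsto_subseq fun n => subset_closure (mem_range_self n)
  exact ⟨P₀, φ, hφ, h⟩

lemma isTight_range_of_tendsto {X : Type*} [MetricSpace X] [SecondCountableTopology X]
    [CompleteSpace X] [MeasurableSpace X] [BorelSpace X] {P : ℕ → ProbabilityMeasure X}
    {P₀ : ProbabilityMeasure X} (hP : Tendsto P atTop (𝓝 P₀)) :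
    IsTightMeasureSet (range fun n => (P n : Measure X)) := by
  have hc : IsCompact (closure (range P)) :=
    hP.isCompact_insert_range.closure_of_subset (subset_insert _ _)
  refine (isTightMeasureSet_of_isCompact_closure hc).subset ?_
  rintro _ ⟨n, rfl⟩
  exact ⟨P n, mem_range_self n, rfl⟩

/-! ### Strassen's theorem -/

section Strassen

variable {d : ℕ} {μ ρ : Measure (E d)}

/-- The martingale constraint need only be tested against bounded continuous functions of the first
coordinate. -/
lemma MartCoupling.of_integral_smul_eq {π : Measure (E d × E d)} [IsProbabilityMeasure π]
    (hμ : μ ∈ P1 d) (hρ : ρ ∈ P1 d) (hfst : π.fst = μ) (hsnd : π.snd = ρ)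
    (h : ∀ (f : E d → ℝ) (C : ℝ), Continuous f → (∀ x, |f x| ≤ C) →
      ∫ w, f w.1 • w.2 ∂π = ∫ x, f x • x ∂μ) : MartCoupling μ ρ π := by
  have hint : Integrable (fun w : E d × E d => w.2) π := integrable_snd_iff.2 (hsnd ▸ hρ.2)
  have hm : Integrable (condMean π) μ := hfst ▸ integrable_condMean hint
  have hae : ∀ᵐ x ∂μ, condMean π x - x = 0 := by
    have := hμ.1
    refine ae_eq_zero_of_integral_contDiff_smul_eq_zero (hm.sub hμ.2).locallyIntegrable ?_
    intro f hf hsupp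
    obtain ⟨C, hC⟩ := hsupp.exists_bound_of_continuous hf.continuous
    have hi1 : Integrable (fun x => f x • condMean π x) μ :=
      integrable_smul_of_bounded hf.continuous.measurable hC hm
    have hi2 : Integrable (fun x => f x • x) μ :=
      integrable_smul_of_bounded hf.continuous.measurable hC hμ.2
    have hi3 : Integrable (fun w : E d × E d => f w.1 • w.2) π :=
      integrable_smul_of_bounded (hf.continuous.measurable.comp measurable_fst)
        (fun w => hC w.1) hint
    have h1 : ∫ x, f x • condMean π x ∂μ = ∫ w, f w.1 • w.2 ∂π := by
      rw [← Measure.integral_condKernel hi3, hfst]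
      exact integral_congr_ae (ae_of_all _ fun x => (integral_smul (f x) _).symm)
    simp only [smul_sub]
    rw [integral_sub hi1 hi2, ← h f C hf.continuous hC, h1, sub_self]
  refine ⟨hfst, hsnd, fun s hs => ?_⟩
  rw [← setIntegral_condMean hint hs, hfst]
  refine setIntegral_congr_ae hs ?_
  filter_upwards [hae] with x hx _
  exact sub_eq_zero.1 hx

lemma exists_excess_le (hρ : ρ ∈ P1 d) (K : ℝ) {ε : ℝ} (hε : 0 < ε) :
    ∃ R : ℝ, 0 ≤ R ∧ ∫ z, max (K * ‖z‖ - R) 0 ∂ρ ≤ ε := by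
  have := hρ.1
  have hlim : Tendsto (fun n : ℕ => ∫ z, max (K * ‖z‖ - n) 0 ∂ρ) atTop (𝓝 (∫ _z, (0 : ℝ) ∂ρ)) := by
    refine tendsto_integral_of_dominated_convergence (fun z => |K * ‖z‖|)
      (fun n => by fun_prop) (hρ.2.norm.const_mul K).abs (fun n => ae_of_all _ fun z => ?_)
      (ae_of_all _ fun z => ?_)
    · rw [Real.norm_eq_abs, abs_of_nonneg (le_max_right _ _)]
      refine max_le ?_ (abs_nonneg _)
      have : (0 : ℝ) ≤ n := n.cast_nonneg
      linarith [le_abs_self (K * ‖z‖)]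
    · obtain ⟨N, hN⟩ := exists_nat_ge (K * ‖z‖)
      refine tendsto_const_nhds.congr' ?_
      filter_upwards [eventually_ge_atTop N] with n hn
      have : (N : ℝ) ≤ n := by exact_mod_cast hn
      rw [max_eq_right (by linarith)]
  rw [integral_zero] at hlim
  obtain ⟨n, hn⟩ := (hlim.eventually_le_const hε).exists
  exact ⟨n, n.cast_nonneg, hn⟩

/-- The hard half of **Strassen's theorem**: a martingale coupling is obtained as a weak limit of
approximate ones, whose second marginals are all equal to `ρ` and whose first marginals converge
to `μ`. -/
theorem exists_martCoupling (hμ : μ ∈ P1 d) (hρ : ρ ∈ P1 d) (h : LinearGrowthOrder μ ρ) :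
    ∃ π, MartCoupling μ ρ π := by
  have := hμ.1
  have := hρ.1
  let s : ℕ → SimpleFunc (E d) (E d) :=
    SimpleFunc.approxOn (fun x => x) measurable_id univ 0 (mem_univ _)
  have hs : ∀ x, Tendsto (fun n => s n x) atTop (𝓝 x) := fun x =>
    SimpleFunc.tendsto_approxOn measurable_id (mem_univ _) (by simp)
  have hδ : ∀ n : ℕ, (0 : ℝ) < 1 / ((n : ℝ) + 1) := fun n => by positivity
  -- The `n`-th approximate coupling uses the simple function `s n` and the tolerance `1 / (n + 1)`.
  choose π hπ hsnd happ using fun n => exists_approx_coupling hμ hρ h (s n) (hδ n)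
  have hδlim : ∀ C : ℝ, Tendsto (fun n : ℕ => C * (1 / ((n : ℝ) + 1))) atTop (𝓝 0) := fun C => by
    simpa using tendsto_one_div_add_atTop_nhds_zero_nat.const_mul C
  have hlim1 : ∀ (f : E d → ℝ) (C : ℝ), Continuous f → (∀ x, |f x| ≤ C) →
      Tendsto (fun n => ∫ w, f w.1 ∂π n) atTop (𝓝 (∫ x, f x ∂μ)) := by
    intro f C hf hC
    have h1 : Tendsto (fun n => ∫ x, f (s n x) ∂μ) atTop (𝓝 (∫ x, f x ∂μ)) :=
      tendsto_integral_of_dominated_convergence (fun _ => C)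
        (fun n => (hf.measurable.comp (s n).measurable).aestronglyMeasurable)
        (integrable_const C) (fun n => ae_of_all _ fun x => hC _)
        (ae_of_all _ fun x => (hf.tendsto x).comp (hs x))
    have h2 : Tendsto (fun n => ∫ w, f w.1 ∂π n - ∫ x, f (s n x) ∂μ) atTop (𝓝 0) :=
      squeeze_zero_norm (fun n => (happ n f C hf.measurable hC).1) (hδlim C)
    simpa using h2.add h1
  have hlim2 : ∀ (f : E d → ℝ) (C : ℝ), Continuous f → (∀ x, |f x| ≤ C) →
      Tendsto (fun n => ∫ w, f w.1 • w.2 ∂π n) atTop (𝓝 (∫ x, f x • x ∂μ)) := by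
    intro f C hf hC
    have h1 : Tendsto (fun n => ∫ x, f (s n x) • x ∂μ) atTop (𝓝 (∫ x, f x • x ∂μ)) := by
      refine tendsto_integral_of_dominated_convergence (fun x => C * ‖x‖)
        (fun n => ((hf.measurable.comp (s n).measurable).smul measurable_id).aestronglyMeasurable)
        (hμ.2.norm.const_mul C) (fun n => ae_of_all _ fun x => ?_)
        (ae_of_all _ fun x => ((hf.tendsto x).comp (hs x)).smul_const x)
      rw [norm_smul]
      gcongr
      exact hC _
    have h2 : Tendsto (fun n => ∫ w, f w.1 • w.2 ∂π n - ∫ x, f (s n x) • x ∂μ) atTop (𝓝 0) :=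
      squeeze_zero_norm (fun n => (happ n f C hf.measurable hC).2) (hδlim C)
    simpa using h2.add h1
  let P : ℕ → ProbabilityMeasure (E d × E d) := fun n => ⟨π n, hπ n⟩
  let M : ProbabilityMeasure (E d) := ⟨μ, hμ.1⟩
  have hPfst : Tendsto (fun n => (P n).map (f := Prod.fst) (by fun_prop)) atTop (𝓝 M) := by
    rw [ProbabilityMeasure.tendsto_iff_forall_integral_tendsto]
    intro f
    have h1 := hlim1 f ‖f‖ f.continuous fun x => f.norm_coe_le_norm x
    refine h1.congr fun n => ?_
    rw [ProbabilityMeasure.toMeasure_map, integral_map (by fun_prop) (by fun_prop)]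
    rfl
  have htight : IsTightMeasureSet (range fun n => (P n : Measure (E d × E d))) := by
    refine IsTightMeasureSet.prodMk ((isTight_range_of_tendsto hPfst).subset ?_)
      ((isTightMeasureSet_singleton (μ := ρ)).subset ?_)
    · rintro _ ⟨_, ⟨n, rfl⟩, rfl⟩
      exact ⟨n, rfl⟩
    · rintro _ ⟨_, ⟨n, rfl⟩, rfl⟩
      exact hsnd n
  obtain ⟨P₀, φ, hφ, hlim⟩ := exists_subseq_tendsto_of_isTight P htight
  have hfst₀ : (P₀ : Measure (E d × E d)).fst = μ := by
    have h1 := ProbabilityMeasure.tendsto_map_of_tendsto_of_continuous _ _ hlim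
      (f := Prod.fst) continuous_fst
    have h2 := tendsto_nhds_unique h1 (hPfst.comp hφ.tendsto_atTop)
    exact congrArg (fun Q : ProbabilityMeasure (E d) => (Q : Measure (E d))) h2
  have hsnd₀ : (P₀ : Measure (E d × E d)).snd = ρ := by
    have h1 := ProbabilityMeasure.tendsto_map_of_tendsto_of_continuous _ _ hlim
      (f := Prod.snd) continuous_snd
    have h2 : ∀ n, ((P ∘ φ) n).map (f := Prod.snd) (by fun_prop) =
        (⟨ρ, hρ.1⟩ : ProbabilityMeasure (E d)) := fun n => Subtype.ext (hsnd (φ n))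
    simp only [h2] at h1
    have h3 := tendsto_nhds_unique h1 tendsto_const_nhds
    exact congrArg (fun Q : ProbabilityMeasure (E d) => (Q : Measure (E d))) h3
  refine ⟨P₀, MartCoupling.of_integral_smul_eq hμ hρ hfst₀ hsnd₀ fun f C hf hC => ?_⟩
  have hz : ∀ Q : ProbabilityMeasure (E d × E d), (Q : Measure (E d × E d)).snd = ρ →
      Integrable (fun w : E d × E d => f w.1 • w.2) (Q : Measure (E d × E d)) := fun Q hQ =>
    integrable_smul_of_bounded (hf.measurable.comp measurable_fst) (fun w => hC w.1)
      (integrable_snd_iff.2 (hQ ▸ hρ.2))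
  refine ext_inner_left ℝ fun v => ?_
  have hg : Continuous fun w : E d × E d => inner ℝ v (f w.1 • w.2) := by fun_prop
  have hexc : ∀ (R : ℝ) (Q : ProbabilityMeasure (E d × E d)), (Q : Measure (E d × E d)).snd = ρ →
      ∫ w, max (|inner ℝ v (f w.1 • w.2)| - R) 0 ∂(Q : Measure (E d × E d)) ≤
        ∫ z, max (‖v‖ * C * ‖z‖ - R) 0 ∂ρ := by
    intro R Q hQ
    have hm : Integrable (fun z => max (‖v‖ * C * ‖z‖ - R) 0) ρ :=
      ((hρ.2.norm.const_mul _).sub (integrable_const R)).pos_part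
    rw [← hQ, Measure.snd] at hm ⊢
    rw [integral_map (by fun_prop) (by fun_prop)]
    refine integral_mono ?_ (hm.comp_measurable measurable_snd) fun w => ?_
    · exact ((((hz Q hQ).const_inner v).abs).sub (integrable_const R)).pos_part
    · refine max_le_max_right _ (sub_le_sub_right ?_ _)
      refine (abs_real_inner_le_norm _ _).trans ?_
      rw [norm_smul, mul_assoc]
      gcongr
      exact hC _
  have hconv := tendsto_integral_of_excess hlim hg
    (fun n => (hz (P (φ n)) (hsnd (φ n))).const_inner v) ((hz _ hsnd₀).const_inner v) fun ε hε => by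
      obtain ⟨R, hR, hle⟩ := exists_excess_le hρ (‖v‖ * C) hε
      exact ⟨R, hR, fun n => (hexc R (P (φ n)) (hsnd (φ n))).trans hle, (hexc R _ hsnd₀).trans hle⟩
  rw [integral_inner (hz _ hsnd₀)] at hconv
  have hconv2 : Tendsto (fun n => inner ℝ v (∫ w, f w.1 • w.2 ∂π (φ n))) atTop
      (𝓝 (inner ℝ v (∫ x, f x • x ∂μ))) :=
    (((innerSL ℝ v).continuous.tendsto _).comp ((hlim2 f C hf hC).comp hφ.tendsto_atTop))
  refine tendsto_nhds_unique (hconv.congr fun n => ?_) hconv2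
  exact integral_inner (hz (P (φ n)) (hsnd (φ n))) v

end Strassen

/-! ### Vector measures with a density -/

section VectorDensity

variable {α : Type*} [MeasurableSpace α] {d : ℕ} {γ : Measure α}

lemma measurable_vecRnDeriv (q : VectorMeasure α (E d)) : Measurable (vecRnDeriv q γ) :=
  (WithLp.measurable_toLp 2 _).comp
    (measurable_pi_lambda _ fun i => SignedMeasure.measurable_rnDeriv (component q i) γ)

lemma integrable_vecRnDeriv (q : VectorMeasure α (E d)) : Integrable (vecRnDeriv q γ) γ :=
  integrable_piLp_iff.2 fun i => SignedMeasure.integrable_rnDeriv (component q i) γ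

lemma setIntegral_vecRnDeriv [SigmaFinite γ] {q : VectorMeasure α (E d)}
    (hq : VectorMeasure.AbsolutelyContinuous q γ.toENNRealVectorMeasure) {s : Set α}
    (hs : MeasurableSet s) : ∫ a in s, vecRnDeriv q γ a ∂γ = q s := by
  ext i
  have hac : component q i ≪ᵥ γ.toENNRealVectorMeasure := fun t ht => by
    simp [component, VectorMeasure.mapRange_apply, hq ht]
  have h1 := SignedMeasure.withDensityᵥ_rnDeriv_eq (component q i) γ hac
  have h2 := congrArg (fun v : SignedMeasure α => v s) h1
  simp only [withDensityᵥ_apply (SignedMeasure.integrable_rnDeriv (component q i) γ) hs] at h2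
  have h3 := eval_integral_piLp (f := vecRnDeriv q γ) (μ := γ.restrict s)
    (fun j => (SignedMeasure.integrable_rnDeriv (component q j) γ).integrableOn) i
  exact h3.trans h2

lemma withDensityᵥ_absolutelyContinuous_vec {ζ : α → E d} (hζ : Integrable ζ γ) :
    VectorMeasure.AbsolutelyContinuous (γ.withDensityᵥ ζ) γ.toENNRealVectorMeasure := by
  refine VectorMeasure.AbsolutelyContinuous.mk fun s hs h0 => ?_
  rw [Measure.toENNRealVectorMeasure_apply_measurable hs] at h0
  rw [withDensityᵥ_apply hζ hs, Measure.restrict_eq_zero.2 h0, integral_zero_measure]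

lemma vecRnDeriv_withDensityᵥ [SigmaFinite γ] {ζ : α → E d} (hζ : Integrable ζ γ) :
    vecRnDeriv (γ.withDensityᵥ ζ) γ =ᵐ[γ] ζ := by
  refine Integrable.ae_eq_of_forall_setIntegral_eq _ _ (integrable_vecRnDeriv _) hζ
    fun s hs _ => ?_
  rw [setIntegral_vecRnDeriv (withDensityᵥ_absolutelyContinuous_vec hζ) hs,
    withDensityᵥ_apply hζ hs]

end VectorDensity

/-! ### From plans to dominants -/

section Plans

variable {d : ℕ} {μ ν ρ : Measure (E d)}

lemma martCoupling_map_prodMk {γ : Measure (E d × E d)} {e ζ : E d × E d → E d}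
    (he : Measurable e) (hζ : Measurable ζ) (heμ : γ.map e = μ)
    (h : ∀ s, MeasurableSet s → ∫ w in e ⁻¹' s, ζ w ∂γ = ∫ x in s, x ∂μ) :
    MartCoupling μ (γ.map ζ) (γ.map fun w => (e w, ζ w)) := by
  refine ⟨?_, ?_, fun s hs => ?_⟩
  · rw [Measure.fst_map_prodMk hζ, heμ]
  · rw [Measure.snd_map_prodMk he]
  · rw [setIntegral_map (measurable_fst hs) (by fun_prop) (he.prodMk hζ).aemeasurable, ← h s hs]
    rfl

/-- The law of `dq/dγ` dominates both marginals: under `γ`, the conditional mean of `dq/dγ` given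
either coordinate is that coordinate. -/
lemma map_vecRnDeriv_mem_dominants (hμ : μ ∈ P1 d) (hν : ν ∈ P1 d) {γ : Measure (E d × E d)}
    {q : VectorMeasure (E d × E d) (E d)} (h : (γ, q) ∈ PlanPairs μ ν) :
    γ.map (vecRnDeriv q γ) ∈ Dominants μ ν := by
  obtain ⟨⟨hγ, hfst, hsnd⟩, ⟨hq1, hq2⟩, hac⟩ := h
  simp only at hγ hfst hsnd hq1 hq2 hac
  have hm : Measurable (vecRnDeriv q γ) := measurable_vecRnDeriv q
  have hP : γ.map (vecRnDeriv q γ) ∈ P1 d :=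
    ⟨Measure.isProbabilityMeasure_map hm.aemeasurable,
      (integrable_map_measure (by fun_prop) hm.aemeasurable).2 (integrable_vecRnDeriv q)⟩
  have key : ∀ {m : Measure (E d)} {e : E d × E d → E d}, m ∈ P1 d → Measurable e → γ.map e = m →
      q.map e = m.withDensityᵥ (fun x => x) → ConvexOrder m (γ.map (vecRnDeriv q γ)) := by
    intro m e hmP he hem hqe
    refine (martCoupling_map_prodMk he hm hem fun s hs => ?_).convexOrder hmP hP
    rw [setIntegral_vecRnDeriv hac (he hs), ← VectorMeasure.map_apply q he hs, hqe,
      withDensityᵥ_apply hmP.2 hs]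
  exact ⟨hP, key hμ measurable_fst hfst hq1, key hν measurable_snd hsnd hq2⟩

/-! ### From dominants to plans -/

/-- Two couplings with the same second marginal are glued along it, the first coordinates being
conditionally independent. -/
lemma exists_gluing {π₁ π₂ : Measure (E d × E d)} [IsProbabilityMeasure π₁]
    [IsProbabilityMeasure π₂] (h₁ : π₁.snd = ρ) (h₂ : π₂.snd = ρ) :
    ∃ τ : Measure ((E d × E d) × E d), IsProbabilityMeasure τ ∧
      τ.map (fun w => (w.1.1, w.2)) = π₁ ∧ τ.map (fun w => (w.1.2, w.2)) = π₂ := by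
  have hsw₁ : IsProbabilityMeasure (π₁.map Prod.swap) :=
    Measure.isProbabilityMeasure_map (by fun_prop)
  have hsw₂ : IsProbabilityMeasure (π₂.map Prod.swap) :=
    Measure.isProbabilityMeasure_map (by fun_prop)
  have hρ : IsProbabilityMeasure ρ := h₁ ▸ inferInstance
  let k₁ := (π₁.map Prod.swap).condKernel
  let k₂ := (π₂.map Prod.swap).condKernel
  have hk₁ : ρ ⊗ₘ k₁ = π₁.map Prod.swap := by
    rw [← h₁, ← Measure.fst_map_swap]
    exact Measure.disintegrate _ _
  have hk₂ : ρ ⊗ₘ k₂ = π₂.map Prod.swap := by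
    rw [← h₂, ← Measure.fst_map_swap]
    exact Measure.disintegrate _ _
  have hswap : ∀ π : Measure (E d × E d), (π.map Prod.swap).map Prod.swap = π := fun π => by
    rw [Measure.map_map measurable_swap measurable_swap]
    simp
  refine ⟨(ρ ⊗ₘ (k₁ ×ₖ k₂)).map Prod.swap,
    Measure.isProbabilityMeasure_map (by fun_prop), ?_, ?_⟩
  · have h := Measure.compProd_map (μ := ρ) (κ := k₁ ×ₖ k₂) (f := Prod.fst) measurable_fst
    rw [← Kernel.fst_eq, Kernel.fst_prod, hk₁] at h
    rw [← hswap π₁, h, Measure.map_map (by fun_prop) (by fun_prop),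
      Measure.map_map (by fun_prop) (by fun_prop)]
    rfl
  · have h := Measure.compProd_map (μ := ρ) (κ := k₁ ×ₖ k₂) (f := Prod.snd) measurable_snd
    rw [← Kernel.snd_eq, Kernel.snd_prod, hk₂] at h
    rw [← hswap π₂, h, Measure.map_map (by fun_prop) (by fun_prop),
      Measure.map_map (by fun_prop) (by fun_prop)]
    rfl

/-- Every common dominant `ρ` is the law of the last component of a triple `(X, Y, Z)` such that
`γ`, the law of `(X, Y)`, and `q`, with density `𝔼[Z | X, Y]`, form an admissible pair. -/
lemma exists_planPair_of_mem_dominants (hμ : μ ∈ P1 d) (hν : ν ∈ P1 d)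
    (h : ρ ∈ Dominants μ ν) :
    ∃ (τ : Measure ((E d × E d) × E d)) (_ : IsProbabilityMeasure τ), τ.snd = ρ ∧
      (τ.fst, τ.fst.withDensityᵥ (condMean τ)) ∈ PlanPairs μ ν := by
  obtain ⟨hρ, hμρ, hνρ⟩ := h
  obtain ⟨π₁, h₁⟩ := exists_martCoupling hμ hρ (hμρ.linearGrowthOrder hμ hρ)
  obtain ⟨π₂, h₂⟩ := exists_martCoupling hν hρ (hνρ.linearGrowthOrder hν hρ)
  have := h₁.isProbabilityMeasure hμ
  have := h₂.isProbabilityMeasure hν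
  obtain ⟨τ, hτ, hτ₁, hτ₂⟩ := exists_gluing h₁.snd_eq h₂.snd_eq
  have hsnd : τ.snd = ρ := by
    rw [← h₁.snd_eq, ← hτ₁, Measure.snd_map_prodMk (by fun_prop)]
    rfl
  have hint : Integrable (fun w : (E d × E d) × E d => w.2) τ :=
    integrable_snd_iff.2 (hsnd ▸ hρ.2)
  have hmean := integrable_condMean hint
  have key : ∀ {m : Measure (E d)} {e : E d × E d → E d} {π : Measure (E d × E d)}, m ∈ P1 d →
      Measurable e → MartCoupling m ρ π → τ.map (fun w => (e w.1, w.2)) = π →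
      τ.fst.map e = m ∧
        (τ.fst.withDensityᵥ (condMean τ)).map e = m.withDensityᵥ (fun x => x) := by
    intro m e π hm he hπ hτπ
    constructor
    · rw [← hπ.fst_eq, ← hτπ, Measure.fst_map_prodMk (by fun_prop), Measure.fst,
        Measure.map_map he measurable_fst]
      rfl
    · refine VectorMeasure.ext fun s hs => ?_
      rw [VectorMeasure.map_apply _ he hs, withDensityᵥ_apply hmean (he hs),
        withDensityᵥ_apply hm.2 hs, setIntegral_condMean hint (he hs), ← hπ.setIntegral_eq s hs,
        ← hτπ, setIntegral_map (measurable_fst hs) (by fun_prop) (by fun_prop)]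
      rfl
  have k₁ := key hμ measurable_fst h₁ hτ₁
  have k₂ := key hν measurable_snd h₂ hτ₂
  exact ⟨τ, hτ, hsnd, ⟨inferInstance, k₁.1, k₂.1⟩, ⟨k₁.2, k₂.2⟩,
    withDensityᵥ_absolutelyContinuous_vec hmean⟩

end Plans

/-! ### Existence of optimal dominants -/

/-- Lower semicontinuity of `P ↦ ∫ F dP` under weak convergence, for lower semicontinuous `F ≥ 0`:
by the layer cake formula it follows from the case of indicators of open sets. -/
lemma lintegral_le_liminf_of_tendsto {Ω : Type*} [MetricSpace Ω] [MeasurableSpace Ω] [BorelSpace Ω]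
    {P : ℕ → ProbabilityMeasure Ω} {P₀ : ProbabilityMeasure Ω} (hP : Tendsto P atTop (𝓝 P₀))
    {F : Ω → ℝ≥0∞} (hF : LowerSemicontinuous F) :
    ∫⁻ x, F x ∂(P₀ : Measure Ω) ≤ liminf (fun n => ∫⁻ x, F x ∂(P n : Measure Ω)) atTop := by
  have htr : ∀ (N : ℕ) (t : ℝ≥0∞),
      ENNReal.ofReal (ENNReal.truncateToReal N t) = min (N : ℝ≥0∞) t := fun N t =>
    ENNReal.ofReal_toReal (ne_top_of_le_ne_top (ENNReal.natCast_ne_top N) (min_le_left _ _))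
  have hsup : ∀ x, F x = ⨆ N : ℕ, min (N : ℝ≥0∞) (F x) := fun x => by
    rw [← iSup_inf_eq, ENNReal.iSup_natCast, top_inf_eq]
  have hmeas : ∀ N : ℕ, Measurable fun x => min (N : ℝ≥0∞) (F x) := fun N =>
    measurable_const.min hF.measurable
  rw [lintegral_congr hsup, lintegral_iSup hmeas fun N N' h x =>
    min_le_min_right _ (by exact_mod_cast h)]
  refine iSup_le fun N => ?_
  have hlsc : LowerSemicontinuous fun x => ENNReal.truncateToReal N (F x) :=
    (ENNReal.continuous_truncateToReal (ENNReal.natCast_ne_top N)).comp_lowerSemicontinuous hF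
      (ENNReal.monotone_truncateToReal (ENNReal.natCast_ne_top N))
  have hcake : ∀ Q : Measure Ω, ∫⁻ x, min (N : ℝ≥0∞) (F x) ∂Q =
      ∫⁻ t in Ioi (0 : ℝ), Q {x | t < ENNReal.truncateToReal N (F x)} := fun Q => by
    rw [← lintegral_eq_lintegral_meas_lt Q (ae_of_all _ fun x => ENNReal.truncateToReal_nonneg)
      hlsc.measurable.aemeasurable]
    simp only [htr]
  calc ∫⁻ x, min (N : ℝ≥0∞) (F x) ∂(P₀ : Measure Ω)
      = ∫⁻ t in Ioi (0 : ℝ), (P₀ : Measure Ω) {x | t < ENNReal.truncateToReal N (F x)} := hcake _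
    _ ≤ ∫⁻ t in Ioi (0 : ℝ), liminf (fun n =>
          (P n : Measure Ω) {x | t < ENNReal.truncateToReal N (F x)}) atTop :=
        lintegral_mono fun t =>
          ProbabilityMeasure.le_liminf_measure_open_of_tendsto hP (hlsc.isOpen_preimage t)
    _ ≤ liminf (fun n => ∫⁻ t in Ioi (0 : ℝ),
          (P n : Measure Ω) {x | t < ENNReal.truncateToReal N (F x)}) atTop :=
        lintegral_liminf_le fun n => Antitone.measurable fun s t hst =>
          measure_mono fun x hx => lt_of_le_of_lt hst hx
    _ ≤ liminf (fun n => ∫⁻ x, F x ∂(P n : Measure Ω)) atTop := by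
        simp only [← hcake]
        exact liminf_le_liminf (Eventually.of_forall fun n =>
          lintegral_mono fun x => min_le_right _ _)

/-- Superlinearity for functions with values in `[0, +∞]`. -/
def SuperlinearENN {d : ℕ} (F : E d → ℝ≥0∞) : Prop :=
  ∀ M : ℝ, ∃ R : ℝ, 0 < R ∧ ∀ z : E d, R ≤ ‖z‖ → ENNReal.ofReal (M * ‖z‖) ≤ F z

section Existence

variable {d : ℕ} {μ ν : Measure (E d)} {F : E d → ℝ≥0∞}

lemma integrable_id_of_superlinear (hF : SuperlinearENN F) {ρ : Measure (E d)}
    [IsProbabilityMeasure ρ] (h : ∫⁻ z, F z ∂ρ ≠ ∞) : Integrable (fun z : E d => z) ρ := by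
  obtain ⟨R, hR, hRF⟩ := hF 1
  refine ⟨by fun_prop, ?_⟩
  have hle : ∀ z : E d, ‖z‖ₑ ≤ ENNReal.ofReal R + F z := fun z => by
    rw [← ofReal_norm]
    rcases le_total R ‖z‖ with hz | hz
    · exact (by simpa using hRF z hz : ENNReal.ofReal ‖z‖ ≤ F z).trans le_add_self
    · exact (ENNReal.ofReal_le_ofReal hz).trans le_self_add
  refine (lintegral_mono hle).trans_lt ?_
  rw [lintegral_add_left measurable_const, lintegral_const, measure_univ, mul_one]
  exact ENNReal.add_lt_top.2 ⟨ENNReal.ofReal_lt_top, h.lt_top⟩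

lemma isTight_of_superlinear (hF : SuperlinearENN F) (hFm : Measurable F) {K : ℝ≥0∞} (hK : K ≠ ∞)
    {S : Set (Measure (E d))} (hS : ∀ ρ ∈ S, ∫⁻ z, F z ∂ρ ≤ K) : IsTightMeasureSet S := by
  rw [isTightMeasureSet_iff_exists_isCompact_measure_compl_le]
  intro ε hε
  by_cases hεtop : ε = ∞
  · exact ⟨∅, isCompact_empty, fun _ _ => hεtop ▸ le_top⟩
  -- Outside a large ball `F ≥ M ≥ K / ε`, and Markov's inequality applies.
  set M : ℝ := (K / ε).toReal + 1
  have hM : 0 < M := by positivity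
  obtain ⟨R, hR, hRF⟩ := hF M
  refine ⟨Metric.closedBall 0 (max R 1), isCompact_closedBall _ _, fun ρ hρ => ?_⟩
  have hsub : (Metric.closedBall (0 : E d) (max R 1))ᶜ ⊆ {z | ENNReal.ofReal M ≤ F z} := by
    intro z hz
    have hz' : max R 1 < ‖z‖ := by simpa using hz
    refine (ENNReal.ofReal_le_ofReal ?_).trans (hRF z ((le_max_left _ _).trans hz'.le))
    exact le_mul_of_one_le_right hM.le ((le_max_right _ _).trans hz'.le)
  have hMne : ENNReal.ofReal M ≠ 0 := by simpa using hM
  refine (measure_mono hsub).trans ((meas_ge_le_lintegral_div hFm.aemeasurable hMne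
    ENNReal.ofReal_ne_top).trans ?_)
  rw [ENNReal.div_le_iff hMne ENNReal.ofReal_ne_top]
  have hKε : K / ε ≤ ENNReal.ofReal M := by
    rw [← ENNReal.ofReal_toReal (ENNReal.div_ne_top hK hε.ne')]
    exact ENNReal.ofReal_le_ofReal (by simp [M])
  refine (hS ρ hρ).trans ?_
  rw [mul_comm]
  exact (ENNReal.div_le_iff hε.ne' hεtop).1 hKε

/-- The de la Vallée-Poussin criterion: a bound on `∫ F dρ` for a superlinear `F` makes functions of
linear growth uniformly integrable. -/
lemma exists_excess_le_of_superlinear (hF : SuperlinearENN F) (hFm : Measurable F) {K : ℝ≥0∞}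
    (hK : K ≠ ∞) {A : ℝ} {φ : E d → ℝ} (hφ : Continuous φ) (hA : ∀ x, |φ x| ≤ A * (1 + ‖x‖))
    {ε : ℝ} (hε : 0 < ε) :
    ∃ R : ℝ, 0 ≤ R ∧ ∀ ρ : Measure (E d), ∫⁻ z, F z ∂ρ ≤ K →
      ∫ z, max (|φ z| - R) 0 ∂ρ ≤ ε := by
  have hA0 : 0 ≤ A := by simpa using (abs_nonneg _).trans (hA 0)
  -- Where `|φ|` exceeds the chosen level, it is at most `2 A ‖z‖ ≤ (2 A / M) F z`, and
  -- `2 A K / M ≤ ε`.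
  set M : ℝ := 2 * A * K.toReal / ε + 1
  have hM : 0 < M := by positivity
  obtain ⟨R, hR, hRF⟩ := hF M
  -- `|φ z| > A * (1 + max R 1)` forces `‖z‖ > max R 1`.
  refine ⟨A * (1 + max R 1), by positivity, fun ρ hρ => ?_⟩
  have hpt : ∀ z, ENNReal.ofReal (max (|φ z| - A * (1 + max R 1)) 0) ≤
      ENNReal.ofReal (2 * A / M) * F z := by
    intro z
    rcases le_total ‖z‖ (max R 1) with hz | hz
    · rw [max_eq_right, ENNReal.ofReal_zero]
      · exact zero_le
      · have : A * (1 + ‖z‖) ≤ A * (1 + max R 1) := by gcongr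
        linarith [hA z]
    · have h1 : 1 ≤ ‖z‖ := (le_max_right _ _).trans hz
      calc ENNReal.ofReal (max (|φ z| - A * (1 + max R 1)) 0)
          ≤ ENNReal.ofReal (2 * A / M * (M * ‖z‖)) := by
            refine ENNReal.ofReal_le_ofReal (max_le ?_ (by positivity))
            have h2 : 2 * A / M * (M * ‖z‖) = A * (‖z‖ + ‖z‖) := by field_simp; ring
            have h3 : A * (1 + ‖z‖) ≤ A * (‖z‖ + ‖z‖) := by gcongr
            have h4 : 0 ≤ A * (1 + max R 1) := by positivity
            linarith [hA z]
        _ = ENNReal.ofReal (2 * A / M) * ENNReal.ofReal (M * ‖z‖) :=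
            ENNReal.ofReal_mul (by positivity)
        _ ≤ ENNReal.ofReal (2 * A / M) * F z := by
            gcongr
            exact hRF z ((le_max_left _ _).trans hz)
  rw [integral_eq_lintegral_of_nonneg_ae (f := fun z => max (|φ z| - A * (1 + max R 1)) 0)
    (ae_of_all _ fun z => le_max_right _ _) (by fun_prop)]
  refine ENNReal.toReal_le_of_le_ofReal hε.le ((lintegral_mono hpt).trans ?_)
  rw [lintegral_const_mul _ hFm]
  calc ENNReal.ofReal (2 * A / M) * ∫⁻ z, F z ∂ρ
      ≤ ENNReal.ofReal (2 * A / M) * ENNReal.ofReal K.toReal := by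
        rw [ENNReal.ofReal_toReal hK]
        gcongr
    _ = ENNReal.ofReal (2 * A / M * K.toReal) := (ENNReal.ofReal_mul (by positivity)).symm
    _ ≤ ENNReal.ofReal ε := by
        apply ENNReal.ofReal_le_ofReal
        rw [div_mul_eq_mul_div, div_le_iff₀ hM]
        have : ε * M = 2 * A * K.toReal + ε := by simp only [M]; field_simp
        linarith

/-- Bounds on `∫ F dρₙ` pass to the limit, and the dominance constraints, tested against functions
of linear growth, are stable under limits with uniform integrability. Strassen's theorem recovers
the full convex order. -/
lemma mem_dominants_of_tendsto (hF : ConvexLSC F) (hFs : SuperlinearENN F) (hμ : μ ∈ P1 d)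
    (hν : ν ∈ P1 d) {K : ℝ≥0∞} (hK : K ≠ ∞) {P : ℕ → ProbabilityMeasure (E d)}
    {P₀ : ProbabilityMeasure (E d)} (hP : Tendsto P atTop (𝓝 P₀))
    (hdom : ∀ n, (P n : Measure (E d)) ∈ Dominants μ ν)
    (hle : ∀ n, ∫⁻ z, F z ∂(P n : Measure (E d)) ≤ K) :
    (P₀ : Measure (E d)) ∈ Dominants μ ν := by
  have hle₀ : ∫⁻ z, F z ∂(P₀ : Measure (E d)) ≤ K :=
    (lintegral_le_liminf_of_tendsto hP hF.lsc).trans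
      (liminf_le_of_le (by isBoundedDefault) fun b hb => by
        obtain ⟨n, hn⟩ := hb.exists
        exact hn.trans (hle n))
  have hP₀ : (P₀ : Measure (E d)) ∈ P1 d :=
    ⟨inferInstance, integrable_id_of_superlinear hFs (ne_top_of_le_ne_top hK hle₀)⟩
  have key : ∀ m ∈ P1 d, (∀ n, ConvexOrder m (P n : Measure (E d))) →
      ConvexOrder m (P₀ : Measure (E d)) := by
    intro m hm hord
    have hlin : LinearGrowthOrder m (P₀ : Measure (E d)) := by
      rintro φ hφ ⟨A, hA⟩
      have hφc := continuous_of_convexOn_univ hφ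
      have hlim := tendsto_integral_of_excess hP hφc
        (fun n => integrable_of_linearGrowth (hdom n).1 hφc hA)
        (integrable_of_linearGrowth hP₀ hφc hA) fun ε hε => by
          obtain ⟨R, hR, h⟩ := exists_excess_le_of_superlinear hFs hF.measurable hK hφc hA hε
          exact ⟨R, hR, fun n => h _ (hle n), h _ hle₀⟩
      exact ge_of_tendsto' hlim fun n =>
        (hord n).linearGrowthOrder hm (hdom n).1 φ hφ ⟨A, hA⟩
    obtain ⟨π, hπ⟩ := exists_martCoupling hm hP₀ hlin
    exact hπ.convexOrder hm hP₀
  exact ⟨hP₀, key μ hμ fun n => (hdom n).2.1, key ν hν fun n => (hdom n).2.2⟩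

lemma exists_minimal_dominant (hF : ConvexLSC F) (hFs : SuperlinearENN F) (hμ : μ ∈ P1 d)
    (hν : ν ∈ P1 d) (hfin : ∃ ρ ∈ Dominants μ ν, ∫⁻ z, F z ∂ρ < ∞) :
    ∃ ρ ∈ Dominants μ ν, ∀ ρ' ∈ Dominants μ ν, ∫⁻ z, F z ∂ρ ≤ ∫⁻ z, F z ∂ρ' := by
  set J : ℝ≥0∞ := ⨅ ρ ∈ Dominants μ ν, ∫⁻ z, F z ∂ρ with hJdef
  have hJ : J ≠ ∞ := by
    obtain ⟨ρ, hρ, hlt⟩ := hfin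
    exact ((iInf₂_le ρ hρ).trans_lt hlt).ne
  have hex : ∀ n : ℕ, ∃ ρ ∈ Dominants μ ν, ∫⁻ z, F z ∂ρ < J + (n + 1 : ℝ≥0∞)⁻¹ := fun n => by
    have h1 : J < J + (n + 1 : ℝ≥0∞)⁻¹ :=
      ENNReal.lt_add_right hJ (ENNReal.inv_ne_zero.2 (by finiteness))
    simpa only [hJdef, iInf_lt_iff, exists_prop] using h1
  choose ρ hρ hlt using hex
  let P : ℕ → ProbabilityMeasure (E d) := fun n => ⟨ρ n, (hρ n).1.1⟩
  have hK : ∀ n, ∫⁻ z, F z ∂ρ n ≤ J + 1 := fun n => by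
    refine (hlt n).le.trans ?_
    gcongr
    exact ENNReal.inv_le_one.2 le_add_self
  have htight : IsTightMeasureSet (range fun n => (P n : Measure (E d))) :=
    isTight_of_superlinear hFs hF.measurable (K := J + 1) (by finiteness) (by
      rintro _ ⟨n, rfl⟩
      exact hK n)
  obtain ⟨P₀, φ, hφ, hlim⟩ := exists_subseq_tendsto_of_isTight P htight
  refine ⟨P₀, mem_dominants_of_tendsto hF hFs hμ hν (K := J + 1) (by finiteness) hlim
    (fun n => hρ (φ n)) fun n => hK (φ n), fun ρ' hρ' => ?_⟩
  have hJle : J ≤ ∫⁻ z, F z ∂ρ' := iInf₂_le ρ' hρ'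
  refine le_trans ?_ hJle
  have hT : Tendsto (fun n => J + ((φ n : ℝ≥0∞) + 1)⁻¹) atTop (𝓝 J) := by
    have h1 : Tendsto (fun n : ℕ => ((n : ℝ≥0∞) + 1)⁻¹) atTop (𝓝 0) := by
      have := (tendsto_add_atTop_iff_nat 1).2 ENNReal.tendsto_inv_nat_nhds_zero
      simpa using this
    simpa using (tendsto_const_nhds (x := J)).add (h1.comp hφ.tendsto_atTop)
  refine (lintegral_le_liminf_of_tendsto hlim hF.lsc).trans ?_
  rw [← hT.liminf_eq]
  exact liminf_le_liminf (Eventually.of_forall fun n => (hlt (φ n)).le)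

end Existence

/-! ### Reduction to a nonnegative cost -/

section Shift

variable {d : ℕ} {f : E d → EReal} {F : E d → ℝ≥0∞} {c : ℝ}

/-- A superlinear lower semicontinuous function is bounded below. The bound is taken nonpositive, so
that `f - c ≥ f` is superlinear as well. -/
lemma exists_real_le (hbot : ∀ z, f z ≠ ⊥) (hlsc : LowerSemicontinuous f)
    (hsup : Superlinear f) : ∃ c : ℝ, c ≤ 0 ∧ ∀ z, (c : EReal) ≤ f z := by
  obtain ⟨R, hR, hRf⟩ := hsup 0
  obtain ⟨z₀, -, hz₀⟩ := (hlsc.lowerSemicontinuousOn (Metric.closedBall (0 : E d) R)).exists_isMinOn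
    ⟨0, by simpa using hR.le⟩ (isCompact_closedBall _ _)
  obtain ⟨c, -, hc⟩ := EReal.lt_iff_exists_real_btwn.1 (bot_lt_iff_ne_bot.2 (hbot z₀))
  refine ⟨min c 0, min_le_right _ _, fun z => ?_⟩
  rcases le_total R ‖z‖ with hz | hz
  · have h1 := hRf z hz
    rw [zero_mul] at h1
    exact (EReal.coe_le_coe_iff.2 (min_le_right c 0)).trans h1
  · exact (EReal.coe_le_coe_iff.2 (min_le_left c 0)).trans
      (hc.le.trans (hz₀ (by simpa using hz)))

lemma exists_eq_coe_add (h : ∀ z, (c : EReal) ≤ f z) :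
    ∃ F : E d → ℝ≥0∞, ∀ z, f z = (F z : EReal) + (c : EReal) := by
  refine ⟨fun z => (f z - c).toENNReal, fun z => ?_⟩
  rw [EReal.coe_toENNReal, EReal.sub_add_cancel]
  exact EReal.sub_nonneg (by simp) (by simp) |>.2 (h z)

lemma lowerSemicontinuous_of_eq_add (hfF : ∀ z, f z = (F z : EReal) + (c : EReal))
    (hlsc : LowerSemicontinuous f) : LowerSemicontinuous F := by
  rw [lowerSemicontinuous_iff_isOpen_preimage]
  intro t
  have : F ⁻¹' Ioi t = f ⁻¹' Ioi ((t : EReal) + (c : EReal)) := by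
    ext z
    simp only [mem_preimage, mem_Ioi, hfF z]
    rw [← not_le, ← not_le, (EReal.addLECancellable_coe c).add_le_add_iff_right,
      EReal.coe_ennreal_le_coe_ennreal_iff]
  rw [this]
  exact hlsc.isOpen_preimage _

/-- The affine combination of two values of `f = F + c`, in terms of `F`. -/
lemma combo_eq_of_eq_add (hfF : ∀ z, f z = (F z : EReal) + (c : EReal)) (x y : E d) {a b : ℝ}
    (ha : 0 < a) (hb : 0 < b) (hab : a + b = 1) :
    (a : EReal) * f x + (b : EReal) * f y =
      ((ENNReal.ofReal a * F x + ENNReal.ofReal b * F y : ℝ≥0∞) : EReal) + (c : EReal) := by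
  have h1 : ∀ (s : ℝ) (z : E d), 0 < s → (s : EReal) * f z =
      ((ENNReal.ofReal s * F z : ℝ≥0∞) : EReal) + ((s * c : ℝ) : EReal) := by
    intro s z hs
    rw [hfF z, EReal.left_distrib_of_nonneg_of_ne_top (by exact_mod_cast hs.le)
      (EReal.coe_ne_top s),
      ← EReal.coe_mul]
    congr 1
    rw [EReal.coe_ennreal_mul, EReal.coe_ennreal_ofReal, max_eq_left hs.le]
  rw [h1 a x ha, h1 b y hb, EReal.coe_ennreal_add, add_add_add_comm, ← EReal.coe_add, ← add_mul,
    hab, one_mul]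

lemma convexLSC_of_eq_add (hfF : ∀ z, f z = (F z : EReal) + (c : EReal)) (hconv : ConvexFun f)
    (hlsc : LowerSemicontinuous f) : ConvexLSC F := by
  refine ⟨lowerSemicontinuous_of_eq_add hfF hlsc, fun x y a b ha hb hab => ?_⟩
  have h := hconv x y a b ha hb hab
  rwa [combo_eq_of_eq_add hfF x y ha hb hab, hfF,
    (EReal.addLECancellable_coe c).add_le_add_iff_right, EReal.coe_ennreal_le_coe_ennreal_iff] at h

lemma lt_combo_of_strictConvexFun (hfF : ∀ z, f z = (F z : EReal) + (c : EReal))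
    (hs : StrictConvexFun f) (x y : E d) (hxy : x ≠ y) (hx : F x < ∞) (hy : F y < ∞) :
    F ((1 / 2 : ℝ) • x + (1 / 2 : ℝ) • y) <
      ENNReal.ofReal (1 / 2) * F x + ENNReal.ofReal (1 / 2) * F y := by
  have htop : ∀ z, F z < ∞ → f z < ⊤ := fun z hz => by
    rw [hfF z]
    exact EReal.add_lt_top (by simpa using hz.ne) (by simp)
  have hhalf : (0 : ℝ) < 1 / 2 := by norm_num
  have h := hs.2 x y hxy (htop x hx) (htop y hy) _ _ hhalf hhalf (by norm_num)
  rwa [combo_eq_of_eq_add hfF x y hhalf hhalf (by norm_num), hfF, ← not_le,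
    (EReal.addLECancellable_coe c).add_le_add_iff_right, EReal.coe_ennreal_le_coe_ennreal_iff,
    not_le] at h

lemma superlinearENN_of_eq_add (hfF : ∀ z, f z = (F z : EReal) + (c : EReal)) (hc : c ≤ 0)
    (hsup : Superlinear f) : SuperlinearENN F := by
  intro M
  obtain ⟨R, hR, hRf⟩ := hsup M
  refine ⟨R, hR, fun z hz => ?_⟩
  have h1 : ((M * ‖z‖ : ℝ) : EReal) ≤ (F z : EReal) := by
    refine (hRf z hz).trans ?_
    rw [hfF z]
    exact (add_le_add_right (EReal.coe_le_coe_iff.2 hc) _).trans_eq (by simp)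
  simpa only [EReal.real_coe_toENNReal, EReal.toENNReal_coe] using
    EReal.toENNReal_le_toENNReal h1

lemma extIntegral_comp_of_eq_add {α : Type*} [MeasurableSpace α] {γ : Measure α}
    [IsProbabilityMeasure γ] (hfF : ∀ z, f z = (F z : EReal) + (c : EReal)) (hF : Measurable F)
    {ζ : α → E d} (hζ : Measurable ζ) :
    extIntegral (fun a => f (ζ a)) γ = ((∫⁻ z, F z ∂γ.map ζ : ℝ≥0∞) : EReal) + (c : EReal) := by
  rw [extIntegral_eq_of_eq_add (l := fun _ => c) (hF.comp hζ) (integrable_const c)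
    (fun a => hfF (ζ a)), lintegral_map hF hζ, integral_const, probReal_univ, one_smul]
  rfl

lemma extIntegral_of_eq_add {ρ : Measure (E d)} [IsProbabilityMeasure ρ]
    (hfF : ∀ z, f z = (F z : EReal) + (c : EReal)) (hF : Measurable F) :
    extIntegral f ρ = ((∫⁻ z, F z ∂ρ : ℝ≥0∞) : EReal) + (c : EReal) := by
  simpa using extIntegral_comp_of_eq_add hfF hF (γ := ρ) measurable_id

end Shift

end BiMart

open BiMart in
theorem mainTheorem8 (d : ℕ) (b : BiMart.E d) (μ ν : Measure (BiMart.E d))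
    (hμ : μ ∈ BiMart.P1b b) (hν : ν ∈ BiMart.P1b b)
    (f : BiMart.E d → EReal) (hf_bot : ∀ z, f z ≠ ⊥) (hf_conv : BiMart.ConvexFun f)
    (hf_lsc : LowerSemicontinuous f) (hf_super : BiMart.Superlinear f) :
    -- the two infima agree
    BiMart.dominanceInf f μ ν = BiMart.biMartInf (fun _ _ z => f z) μ ν ∧
    -- an admissible pair `(γ, q) = (γ, ζ γ)` is optimal iff `ζ # γ` is an optimal dominant
    (∀ (γ : Measure (BiMart.E d × BiMart.E d))
      (q : VectorMeasure (BiMart.E d × BiMart.E d) (BiMart.E d))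
      (ζ : BiMart.E d × BiMart.E d → BiMart.E d),
      (γ, q) ∈ BiMart.PlanPairs μ ν → ζ =ᵐ[γ] BiMart.vecRnDeriv q γ →
        (BiMart.IsOptimalPair (fun _ _ z => f z) μ ν (γ, q) ↔
          BiMart.IsOptimalDominant f μ ν (γ.map ζ))) ∧
    -- for strictly convex `f`, every optimal dominant arises in this way
    (BiMart.StrictConvexFun f → BiMart.dominanceInf f μ ν < ⊤ →
      ∀ ρ, BiMart.IsOptimalDominant f μ ν ρ →
        ∃ (γ : Measure (BiMart.E d × BiMart.E d))
          (q : VectorMeasure (BiMart.E d × BiMart.E d) (BiMart.E d)),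
          BiMart.IsOptimalPair (fun _ _ z => f z) μ ν (γ, q) ∧
          ρ = γ.map (BiMart.vecRnDeriv q γ)) ∧
    -- existence of an optimal dominant
    (BiMart.dominanceInf f μ ν < ⊤ → ∃ ρ, BiMart.IsOptimalDominant f μ ν ρ) := by
  obtain ⟨c, hc, hcf⟩ := exists_real_le hf_bot hf_lsc hf_super
  obtain ⟨F, hfF⟩ := exists_eq_coe_add hcf
  have hF := convexLSC_of_eq_add hfF hf_conv hf_lsc
  have hFs := superlinearENN_of_eq_add hfF hc hf_super
  have hext : ∀ ρ ∈ P1 d,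
      extIntegral f ρ = ((∫⁻ z, F z ∂ρ : ℝ≥0∞) : EReal) + (c : EReal) := fun ρ hρ =>
    have := hρ.1
    extIntegral_of_eq_add hfF hF.measurable
  have hle_iff : ∀ ρ ∈ P1 d, ∀ ρ' ∈ P1 d,
      (extIntegral f ρ ≤ extIntegral f ρ' ↔ ∫⁻ z, F z ∂ρ ≤ ∫⁻ z, F z ∂ρ') := fun ρ hρ ρ' hρ' => by
    rw [hext ρ hρ, hext ρ' hρ', (EReal.addLECancellable_coe c).add_le_add_iff_right,
      EReal.coe_ennreal_le_coe_ennreal_iff]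
  have hcost : ∀ γ q, (γ, q) ∈ PlanPairs μ ν →
      pairCost (fun _ _ z => f z) (γ, q) = extIntegral f (γ.map (vecRnDeriv q γ)) := by
    intro γ q h
    have := h.1.1
    rw [hext _ (map_vecRnDeriv_mem_dominants hμ.1 hν.1 h).1]
    exact extIntegral_comp_of_eq_add hfF hF.measurable (measurable_vecRnDeriv q)
  -- A gluing `τ` over `ρ` gives a pair whose density has the law of the conditional mean.
  have hlift : ∀ ρ ∈ Dominants μ ν, ∃ (τ : Measure ((E d × E d) × E d))
      (_ : IsProbabilityMeasure τ), τ.snd = ρ ∧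
      (τ.fst, τ.fst.withDensityᵥ (condMean τ)) ∈ PlanPairs μ ν ∧
      τ.fst.map (vecRnDeriv (τ.fst.withDensityᵥ (condMean τ)) τ.fst) =
        τ.fst.map (condMean τ) ∧
      Integrable (fun w : (E d × E d) × E d => w.2) τ ∧
      pairCost (fun _ _ z => f z) (τ.fst, τ.fst.withDensityᵥ (condMean τ)) ≤ extIntegral f ρ := by
    intro ρ hρ
    obtain ⟨τ, hτ, hsnd, hpair⟩ := exists_planPair_of_mem_dominants hμ.1 hν.1 hρ
    have hint : Integrable (fun w : (E d × E d) × E d => w.2) τ :=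
      integrable_snd_iff.2 (hsnd ▸ hρ.1.2)
    have hmap : τ.fst.map (vecRnDeriv (τ.fst.withDensityᵥ (condMean τ)) τ.fst) =
        τ.fst.map (condMean τ) :=
      Measure.map_congr (vecRnDeriv_withDensityᵥ (integrable_condMean hint))
    refine ⟨τ, hτ, hsnd, hpair, hmap, hint, ?_⟩
    have hdom := map_vecRnDeriv_mem_dominants hμ.1 hν.1 hpair
    rw [hcost _ _ hpair, hle_iff _ hdom.1 _ hρ.1, hmap, ← hsnd,
      lintegral_map hF.measurable (measurable_condMean τ)]
    exact lintegral_condMean_le hF hint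
  have hinf : dominanceInf f μ ν = biMartInf (fun _ _ z => f z) μ ν := by
    apply le_antisymm
    · refine le_iInf₂ fun p hp => ?_
      rw [hcost p.1 p.2 hp]
      exact iInf₂_le _ (map_vecRnDeriv_mem_dominants hμ.1 hν.1 hp)
    · refine le_iInf₂ fun ρ hρ => ?_
      obtain ⟨τ, _, -, hpair, -, -, hle⟩ := hlift ρ hρ
      exact (iInf₂_le _ hpair).trans hle
  refine ⟨hinf, fun γ q ζ hp hζ => ?_, fun hs hfin ρ hρ => ?_, fun hfin => ?_⟩
  · rw [Measure.map_congr hζ]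
    simp only [IsOptimalPair, IsOptimalDominant, hp, hcost γ q hp, hinf, true_and,
      map_vecRnDeriv_mem_dominants hμ.1 hν.1 hp]
  · obtain ⟨τ, _, hsnd, hpair, hmap, hint, hle⟩ := hlift ρ hρ.1
    rw [hρ.2] at hle
    have hopt : IsOptimalPair (fun _ _ z => f z) μ ν
        (τ.fst, τ.fst.withDensityᵥ (condMean τ)) :=
      ⟨hpair, le_antisymm (hinf ▸ hle) (iInf₂_le _ hpair)⟩
    refine ⟨_, _, hopt, ?_⟩
    have hdom := map_vecRnDeriv_mem_dominants hμ.1 hν.1 hpair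
    have hle' : extIntegral f ρ ≤
        extIntegral f (τ.fst.map (vecRnDeriv (τ.fst.withDensityᵥ (condMean τ)) τ.fst)) :=
      hρ.2.trans_le (iInf₂_le _ hdom)
    rw [hle_iff _ hρ.1.1 _ hdom.1, hmap, lintegral_map hF.measurable (measurable_condMean τ),
      ← hsnd] at hle'
    rw [hmap, ← hsnd]
    refine snd_eq_map_condMean hF (lt_combo_of_strictConvexFun hfF hs) hint hle' ?_
    rw [hsnd]
    rw [← hρ.2, hext ρ hρ.1.1] at hfin
    by_contra htop
    rw [not_lt, top_le_iff] at htop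
    simp [htop] at hfin
  · obtain ⟨ρ₀, hρ₀, hlt⟩ : ∃ ρ ∈ Dominants μ ν, extIntegral f ρ < ⊤ := by
      simpa only [dominanceInf, iInf_lt_iff, exists_prop] using hfin
    rw [hext ρ₀ hρ₀.1] at hlt
    obtain ⟨ρ, hρ, hmin⟩ := exists_minimal_dominant hF hFs hμ.1 hν.1 ⟨ρ₀, hρ₀, by
      by_contra htop
      rw [not_lt, top_le_iff] at htop
      simp [htop] at hlt⟩
    exact ⟨ρ, hρ, le_antisymm
      (le_iInf₂ fun ρ' hρ' => (hle_iff ρ hρ.1 ρ' hρ'.1).2 (hmin ρ' hρ')) (iInf₂_le _ hρ)⟩
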